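/- Let $\mathcal O$ be the square-tiled surface (origami) made of $16$ unit squares, where the right side of square $i$ is glued to the left side of square $h(i)$ and the top side of square $i$ is glued to the bottom side of square $v(i)$, by translations, with $$h=(1,2,3,4,5,6)(12,11,10,9,8,7)(13,14)(15,16),\qquad v=(12,2,16,14,10,6)(11,5,15,13,7,1)(3,9)(4,8).$$ Let $(p,q)\in\mathbb Z^2$ be a primitive vector ($\gcd(p,q)=1$). Then: 1. The homological dimension of $\mathcal O$ in the direction $(p,q)$ is $2$: the waist curves of the cylinders in direction $(p,q)$, i.e. the closed straight leaves in direction $(p,q)$ that avoid the conical singularities of $\mathcal O$, span a $2$-dimensional subspace of $H_1(\mathcal O;\mathbb R)$. The same holds for the closed leaves that avoid all vertices of the squares. 2. Cut $\mathcal O$ along all leaves in direction $(p,q)$ through vertices of the squares (regular vertices included), so that the cylinders are the connected components of the union of the closed leaves in direction $(p,q)$ that avoid all vertices. The union of these cylinders is dense in $\mathcal O$, and there are exactly four of them: two long ones, whose waist curves have length $6\sqrt{p^2+q^2}$, and two short ones, whose waist curves have length $2\sqrt{p^2+q^2}$. All waist curves of the two long cylinders, oriented by $(p,q)$, are homologous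 to each other, and so are all waist curves of the two short cylinders (in $H_1(\mathcal O;\mathbb R)$). -/

import Mathlib

open CategoryTheory

namespace Origami

/-! ### The translation surface of a pair of permutations -/

/-- Gluing rule for `n` closed unit squares `{i} × [0,1] × [0,1]`: the right side of the square `i`
is glued to the left side of the square `h i`, and the top side of the square `i` is glued to the
bottom side of the square `v i`, both by translations. -/
inductive Glue {n : ℕ} (h v : Equiv.Perm (Fin n)) :
    Fin n × unitInterval × unitInterval → Fin n × unitInterval × unitInterval → Prop
  | right (i : Fin n) (y : unitInterval) : Glue h v (i, 1, y) (h i, 0, y)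
  | top (i : Fin n) (x : unitInterval) : Glue h v (i, x, 1) (v i, x, 0)

/-- The square-tiled surface defined by `h` (to the right) and `v` (upwards): the quotient of the
disjoint union of the squares by the equivalence relation generated by the gluing rule. -/
def Surface {n : ℕ} (h v : Equiv.Perm (Fin n)) : Type := Quot (Glue h v)

/-- The quotient topology. -/
instance {n : ℕ} (h v : Equiv.Perm (Fin n)) : TopologicalSpace (Surface h v) :=
  inferInstanceAs (TopologicalSpace (Quot (Glue h v)))

variable {n : ℕ} {h v : Equiv.Perm (Fin n)}

/-- The point of the surface with coordinates `(x, y)` in the square `i`. -/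
def Surface.mk (h v : Equiv.Perm (Fin n)) (i : Fin n) (x y : unitInterval) : Surface h v :=
  Quot.mk _ (i, x, y)

/-- The covering of the square torus `ℝ²/ℤ²`, branched over the origin at most, that sends every
square onto the torus by its coordinates. The translation structure of the surface is the pullback
of that of the torus. -/
def Surface.toTorus : Surface h v → UnitAddCircle × UnitAddCircle :=
  Quot.lift (fun z => (((z.2.1 : ℝ) : UnitAddCircle), ((z.2.2 : ℝ) : UnitAddCircle))) (by
    rintro _ _ (⟨i, y⟩ | ⟨i, x⟩) <;> simp [AddCircle.coe_period])

/-- The set of all vertices of the squares (every corner is the lower left corner of a square). -/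
def vertices (h v : Equiv.Perm (Fin n)) : Set (Surface h v) :=
  {x | ∃ i, x = Surface.mk h v i 0 0}

/-- The set of conical singularities. Turning once around the lower left corner of the square `i`
(left, down, right, up) leads to the square `v h v⁻¹ h⁻¹ i`; the cone angle at the corner is `2π`
times the length of the cycle of `i` under this permutation, so that the corner is a
singularity if and only if `i` is not a fixed point. -/
def conePoints (h v : Equiv.Perm (Fin n)) : Set (Surface h v) :=
  {x | ∃ i, (v * h * v⁻¹ * h⁻¹) i ≠ i ∧ x = Surface.mk h v i 0 0}

/-! ### Cylinders and waist curves -/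

/-- A closed leaf of the straight-line flow in the direction `(p, q)` that avoids the set `P`
(a set of vertices that contains the conical singularities), run through with velocity `(p, q)`,
together with its minimal period. Outside `P` the map to the torus is a local homeomorphism, so
that being straight with velocity `(p, q)` may be tested in the torus. -/
structure ClosedLeaf (P : Set (Surface h v)) (p q : ℤ) where
  /-- The parametrization by time. -/
  toFun : ℝ → Surface h v
  /-- The time of first return. -/
  period : ℝ
  continuous_toFun : Continuous toFun
  avoids : ∀ t, toFun t ∉ P
  straight : ∀ t, (toFun t).toTorus = (toFun 0).toTorus +
    (((t * p : ℝ) : UnitAddCircle), ((t * q : ℝ) : UnitAddCircle))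
  period_pos : 0 < period
  periodic : Function.Periodic toFun period
  minimal : ∀ s, 0 < s → Function.Periodic toFun s → period ≤ s

variable {P : Set (Surface h v)} {p q : ℤ}

/-- The Euclidean length of a closed leaf. -/
noncomputable def ClosedLeaf.length (w : ClosedLeaf P p q) : ℝ :=
  w.period * Real.sqrt ((p : ℝ) ^ 2 + (q : ℝ) ^ 2)

/-- A closed leaf as a loop. -/
noncomputable def ClosedLeaf.loop (w : ClosedLeaf P p q) : Path (w.toFun 0) (w.toFun 0) where
  toFun t := w.toFun (t * w.period)
  continuous_toFun := w.continuous_toFun.comp (by fun_prop)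
  source' := by simp
  target' := by simpa using w.periodic 0

/-- The union of the closed leaves in the direction `(p, q)` that avoid `P`. -/
def closedLeafSet (P : Set (Surface h v)) (p q : ℤ) : Set (Surface h v) :=
  {x | ∃ w : ClosedLeaf P p q, ∃ t, w.toFun t = x}

/-- The cylinders in the direction `(p, q)`, where the points of `P` count as singularities: the
connected components of the union of the closed leaves that avoid `P`. The waist curves
of a cylinder are the closed leaves that it consists of. -/
def cylinders (P : Set (Surface h v)) (p q : ℤ) : Set (Set (Surface h v)) :=
  {C | ∃ x ∈ closedLeafSet P p q, C = connectedComponentIn (closedLeafSet P p q) x}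

/-! ### Homology classes of loops -/

/-- The real singular homology `H₁(X; ℝ)`. -/
noncomputable abbrev H1 (X : Type) [TopologicalSpace X] : ModuleCat ℝ :=
  ((AlgebraicTopology.singularHomologyFunctor (ModuleCat ℝ) 1).obj (ModuleCat.of ℝ ℝ)).obj
    (TopCat.of X)

/-- A path as a singular 1-simplex. -/
noncomputable def pathSimplex {X : Type} [TopologicalSpace X] {x y : X} (γ : Path x y) :
    (TopCat.toSSet.obj (TopCat.of X)).obj (Opposite.op (SimplexCategory.mk 1)) :=
  TopCat.toSSetObj₁Equiv.symm (TopCat.pathEquiv.symm γ).hom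

/-- The singular 1-simplex of a loop is a cycle. -/
theorem pathSimplex_d {X : Type} [TopologicalSpace X] {x : X} (γ : Path x x) :
    SSet.ιChainComplex _ (R := ModuleCat.of ℝ ℝ) (pathSimplex γ) ≫
      ((TopCat.toSSet.obj (TopCat.of X)).chainComplex (ModuleCat.of ℝ ℝ)).d 1 0 = 0 := by
  rw [SSet.ιChainComplex_d]
  have h0 := ((TopCat.pathEquiv (X := TopCat.of X) (x := x) (y := x)).symm γ).hom₀
  have h1 := ((TopCat.pathEquiv (X := TopCat.of X) (x := x) (y := x)).symm γ).hom₁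
  simp only [Fin.sum_univ_two, pathSimplex, Fin.isValue, Nat.reduceAdd, Fin.val_zero, pow_zero,
    TopCat.δ_zero_toSSetObj₁Equiv.symm, TopCat.δ_one_toSSetObj₁Equiv.symm, one_smul, Fin.val_one,
    pow_one, neg_smul]
  erw [h0, h1]
  exact add_neg_cancel _

/-- The class in `H₁(X; ℝ)` of a loop, regarded as a singular 1-cycle with coefficient `1`. -/
noncomputable def loopClass {X : Type} [TopologicalSpace X] {x : X} (γ : Path x x) : H1 X :=
  (((TopCat.toSSet.obj (TopCat.of X)).chainComplex (ModuleCat.of ℝ ℝ)).liftCycles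
      (SSet.ιChainComplex _ (pathSimplex γ)) 0 (by simp) (pathSimplex_d γ) ≫
    ((TopCat.toSSet.obj (TopCat.of X)).chainComplex (ModuleCat.of ℝ ℝ)).homologyπ 1).hom (1 : ℝ)

/-- The homology class of a closed leaf. -/
noncomputable def ClosedLeaf.homologyClass (w : ClosedLeaf P p q) : H1 (Surface h v) :=
  loopClass w.loop

/-- The subspace of `H₁` spanned by the waist curves of all cylinders in the direction `(p, q)`;
its dimension is the homological dimension in that direction. -/
noncomputable def waistSpan (P : Set (Surface h v)) (p q : ℤ) :
    Submodule ℝ (H1 (Surface h v)) :=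
  Submodule.span ℝ (Set.range fun w : ClosedLeaf P p q => w.homologyClass)

/-! ### The origami `𝒪` -/

/-- The horizontal permutation; the label `16` is the element `0` of `Fin 16`. -/
def hO : Equiv.Perm (Fin 16) :=
  c[1, 2, 3, 4, 5, 6] * c[12, 11, 10, 9, 8, 7] * c[13, 14] * c[15, 16]

/-- The vertical permutation. -/
def vO : Equiv.Perm (Fin 16) :=
  c[12, 2, 16, 14, 10, 6] * c[11, 5, 15, 13, 7, 1] * c[3, 9] * c[4, 8]

end Origami

/-! The origami has all of SL₂(ℤ) as symmetries, so one direction suffices. A quarter turn converts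
the pair `(h, v)` into `(v⁻¹, h)`, and the horizontal shear converts it into `(h, v * h⁻¹)`. For
`hO`, `vO` both new pairs are simultaneously conjugate to the old one, by `rotationPerm` and
`shearPerm`. Hence `𝒪` has affine self-homeomorphisms with these two derivatives
(`HasTwoCylinderPairs.rotate`, `shearSelf`). They respect vertices, cone points, closed leaves,
periods, cylinders and homology (`HasTwoCylinderPairs.map`), and the Euclidean algorithm carries
`(1, 0)` to every primitive vector (`HasTwoCylinderPairs.of_horizontal`).

In the horizontal direction a closed leaf that misses the cone points stays at a constant height and
passes through the squares of one cycle of `hO` (`ClosedLeaf.exists_eq_rowPath`). So the cylinders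
are the four open rows, two of length 6 and two of length 2 (`cylinders_horizontal`,
`minimalPeriod_hO`).

Each waist curve can be pushed to the bottom or the top of its row. The tops of the squares 7, ...,
12 are glued to the bottoms of 1, ..., 6, and the tops of 15, 16 to the bottoms of 13, 14, so only
two classes occur (`sum_rowClass_hO`). They are independent because integers that are constant along
vertical cycles define maps to the circle, whose winding numbers separate the two classes
(`exists_column_functional`, `linearIndependent_longClass_shortClass`).

Homology is computed in the 1-chains modulo boundaries, which contain `H1` and in which a loop may
be cut into arcs. -/

namespace Origami
open Simplicial

/-! ### Singular 1-chains modulo boundaries -/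

section Homology

variable {X Y : Type} [TopologicalSpace X] [TopologicalSpace Y]

/-- The singular chain complex with real coefficients. -/
noncomputable abbrev singularChains (X : Type) [TopologicalSpace X] : ChainComplex (ModuleCat ℝ) ℕ :=
  (TopCat.toSSet.obj (TopCat.of X)).chainComplex (ModuleCat.of ℝ ℝ)

/-- The singular 1-simplex of a continuous map on the unit interval. -/
noncomputable def intervalSimplex (f : C(unitInterval, X)) :
    (TopCat.toSSet.obj (TopCat.of X)).obj (Opposite.op (SimplexCategory.mk 1)) :=
  (TopCat.toSSetObjEquiv _ _).symm
    (f.comp (stdSimplexHomeomorphUnitInterval : C(stdSimplex ℝ (Fin 2), unitInterval)))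

theorem intervalSimplex_surjective :
    Function.Surjective (intervalSimplex (X := X)) := by
  intro s
  refine ⟨((TopCat.toSSetObjEquiv _ _) s).comp
    (stdSimplexHomeomorphUnitInterval.symm : C(unitInterval, stdSimplex ℝ (Fin 2))), ?_⟩
  apply (TopCat.toSSetObjEquiv _ _).injective
  ext z
  simp [intervalSimplex]

/-- The class of a singular 1-simplex in the 1-chains modulo boundaries. -/
noncomputable def simplexClass (f : C(unitInterval, X)) : (singularChains X).opcycles 1 :=
  (SSet.ιChainComplex _ (intervalSimplex f) ≫ (singularChains X).pOpcycles 1).hom (1 : ℝ)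

/-- The inclusion of the first homology into the 1-chains modulo boundaries. -/
noncomputable def homologyInclusion (X : Type) [TopologicalSpace X] :
    H1 X →ₗ[ℝ] (singularChains X).opcycles 1 :=
  ((singularChains X).homologyι 1).hom

theorem homologyInclusion_injective : Function.Injective (homologyInclusion X) :=
  (ModuleCat.mono_iff_injective ((singularChains X).homologyι 1)).1 inferInstance

/-- In `opcycles` there is no cycle condition, so the image of a loop can be decomposed into classes
of paths that are not closed. -/
theorem homologyInclusion_loopClass {x : X} (γ : Path x x) :
    homologyInclusion X (loopClass γ) = simplexClass γ.toContinuousMap := by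
  have : (singularChains X).liftCycles
      (SSet.ιChainComplex _ (pathSimplex γ)) 0 (by simp) (pathSimplex_d γ) ≫
    (singularChains X).homologyπ 1 ≫ (singularChains X).homologyι 1 =
      SSet.ιChainComplex _ (pathSimplex γ) ≫ (singularChains X).pOpcycles 1 := by
    simp
  have := congrArg (fun m => m.hom (1 : ℝ)) this
  exact this

/-- The map induced on the first homology by a continuous map. -/
noncomputable def homologyMap (f : C(X, Y)) : H1 X →ₗ[ℝ] H1 Y :=
  (((AlgebraicTopology.singularHomologyFunctor (ModuleCat ℝ) 1).obj (ModuleCat.of ℝ ℝ)).map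
    (TopCat.ofHom f)).hom

theorem homologyMap_loopClass (f : C(X, Y)) {x : X} (γ : Path x x) :
    homologyMap f (loopClass γ) = loopClass (γ.map f.continuous) := by
  apply homologyInclusion_injective
  rw [homologyInclusion_loopClass]
  have e : (TopCat.toSSet.map (TopCat.ofHom f)).app _ (pathSimplex γ) =
    intervalSimplex (γ.map f.continuous).toContinuousMap := rfl
  have : (singularChains X).liftCycles
      (SSet.ιChainComplex _ (pathSimplex γ)) 0 (by simp) (pathSimplex_d γ) ≫
    (singularChains X).homologyπ 1 ≫
      HomologicalComplex.homologyMap (SSet.chainComplexMap (TopCat.toSSet.map (TopCat.ofHom f)) _) 1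
      ≫ (singularChains Y).homologyι 1 =
      SSet.ιChainComplex _ (intervalSimplex (γ.map f.continuous).toContinuousMap)
        ≫ (singularChains Y).pOpcycles 1 := by
    rw [← e]; simp
  have := congrArg (fun m => m.hom (1 : ℝ)) this
  exact this

/-- The faces of a singular 2-simplex, as maps on the unit interval. -/
noncomputable def triangleFace (τ : C(stdSimplex ℝ (Fin 3), X)) (i : Fin 3) :
    C(unitInterval, X) :=
  (τ.comp ⟨stdSimplex.map i.succAbove, stdSimplex.continuous_map _⟩).comp
    (stdSimplexHomeomorphUnitInterval.symm : C(unitInterval, stdSimplex ℝ (Fin 2)))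

theorem intervalSimplex_triangleFace (τ : C(stdSimplex ℝ (Fin 3), X)) (i : Fin 3) :
    intervalSimplex (triangleFace τ i) = (TopCat.toSSet.obj (TopCat.of X)).δ (n := 1) i
      ((TopCat.toSSetObjEquiv (TopCat.of X) (.op ⦋2⦌)).symm τ) := by
  apply (TopCat.toSSetObjEquiv _ _).injective
  ext z
  rw [TopCat.toSSetObjEquiv_δ_apply]
  simp [intervalSimplex, triangleFace]

theorem triangle_d (τ : C(stdSimplex ℝ (Fin 3), X)) :
    SSet.ιChainComplex (R := ModuleCat.of ℝ ℝ) _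
        ((TopCat.toSSetObjEquiv (TopCat.of X) (.op ⦋2⦌)).symm τ) ≫ (singularChains X).d 2 1 =
      SSet.ιChainComplex _ (intervalSimplex (triangleFace τ 0)) -
        SSet.ιChainComplex _ (intervalSimplex (triangleFace τ 1)) +
        SSet.ιChainComplex _ (intervalSimplex (triangleFace τ 2)) := by
  rw [SSet.ιChainComplex_d]
  erw [Fin.sum_univ_three]
  simp only [intervalSimplex_triangleFace]
  simp
  abel

/-- The boundary of a 2-simplex dies in the quotient. This is the only relation on which the later
computations rest. -/
theorem simplexClass_triangle (τ : C(stdSimplex ℝ (Fin 3), X)) :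
    simplexClass (triangleFace τ 2) + simplexClass (triangleFace τ 0) =
      simplexClass (triangleFace τ 1) := by
  have h : SSet.ιChainComplex (R := ModuleCat.of ℝ ℝ) _
      ((TopCat.toSSetObjEquiv (TopCat.of X) (.op ⦋2⦌)).symm τ) ≫
        (singularChains X).d 2 1 ≫ (singularChains X).pOpcycles 1 = 0 := by simp
  rw [← Category.assoc, triangle_d, Preadditive.add_comp, Preadditive.sub_comp] at h
  have := congrArg (fun m => m.hom (1 : ℝ)) h
  rw [← sub_eq_zero]
  refine Eq.trans ?_ this
  simp only [simplexClass, ModuleCat.hom_add, ModuleCat.hom_sub, LinearMap.add_apply,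
    LinearMap.sub_apply]
  abel

theorem stdSimplex_map_succAbove (i : Fin 3) (t : unitInterval) :
    ⇑(stdSimplex.map i.succAbove (stdSimplexHomeomorphUnitInterval.symm t)) =
      ![![0, 1 - (t : ℝ), t], ![1 - (t : ℝ), 0, t], ![1 - (t : ℝ), t, 0]] i := by
  have h0 : (stdSimplexHomeomorphUnitInterval.symm t) 0 = 1 - (t : ℝ) := rfl
  have h1 : (stdSimplexHomeomorphUnitInterval.symm t) 1 = (t : ℝ) := rfl
  have h20 : Fin.succAbove (2 : Fin 3) (0 : Fin 2) = 0 := rfl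
  have h21 : Fin.succAbove (2 : Fin 3) (1 : Fin 2) = 1 := rfl
  ext j
  rw [stdSimplex.map_coe, FunOnFinite.linearMap_apply_apply, Finset.sum_filter, Fin.sum_univ_two,
    h0, h1]
  fin_cases i <;> fin_cases j <;> simp [h20, h21]

/-- The affine segment from `a` to `b`, mapped by `g`. -/
def segment {E : Type} [AddCommGroup E] [Module ℝ E] [TopologicalSpace E]
    [IsTopologicalAddGroup E] [ContinuousSMul ℝ E] (g : C(E, X)) (a b : E) : C(unitInterval, X) :=
  ⟨fun t => g ((1 - (t : ℝ)) • a + (t : ℝ) • b), by fun_prop⟩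

/-- The affine triangle with corners `a`, `b`, `c`, mapped by `g`, has these three segments as
faces. On `ℝ` it cuts paths into pieces; on `ℝ × ℝ` it moves them across a square. -/
theorem simplexClass_segment_add {E : Type} [AddCommGroup E] [Module ℝ E] [TopologicalSpace E]
    [IsTopologicalAddGroup E] [ContinuousSMul ℝ E] (g : C(E, X)) (a b c : E) :
    simplexClass (segment g a b) + simplexClass (segment g b c) =
      simplexClass (segment g a c) := by
  have hc : ∀ i : Fin 3, Continuous fun z : stdSimplex ℝ (Fin 3) => z i := fun i =>
    (continuous_apply i).comp continuous_subtype_val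
  let τ : C(stdSimplex ℝ (Fin 3), X) := ⟨fun z => g (z 0 • a + z 1 • b + z 2 • c),
    g.continuous.comp ((((hc 0).smul continuous_const).add ((hc 1).smul continuous_const)).add
      ((hc 2).smul continuous_const))⟩
  have h := simplexClass_triangle τ
  have e : ∀ i t, triangleFace τ i t =
      τ (stdSimplex.map i.succAbove (stdSimplexHomeomorphUnitInterval.symm t)) := fun i t => rfl
  have h2 : triangleFace τ 2 = segment g a b := by
    ext t
    rw [e]
    simp only [τ, segment, stdSimplex_map_succAbove, ContinuousMap.coe_mk]; simp
  have h0 : triangleFace τ 0 = segment g b c := by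
    ext t
    rw [e]
    simp only [τ, segment, stdSimplex_map_succAbove, ContinuousMap.coe_mk]; simp
  have h1 : triangleFace τ 1 = segment g a c := by
    ext t
    rw [e]
    simp only [τ, segment, stdSimplex_map_succAbove, ContinuousMap.coe_mk]; simp
  rwa [h2, h0, h1] at h

/-! ### Change of argument along paths in the circle -/

/-- Lifting of maps to the circle. -/
theorem exists_lift_circle {A : Type} [TopologicalSpace A] [SimplyConnectedSpace A]
    [LocallyPathConnectedSpace A] (c : C(A, UnitAddCircle)) :
    ∃ F : C(A, ℝ), ∀ t, (F t : UnitAddCircle) = c t := by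
  obtain ⟨a⟩ : Nonempty A := inferInstance
  obtain ⟨e, he⟩ := QuotientAddGroup.mk_surjective (c a)
  obtain ⟨F, ⟨-, hF⟩, -⟩ := (AddCircle.isCoveringMap_coe (1 : ℝ)).existsUnique_continuousMap_lifts
    c a e he
  exact ⟨F, fun t => congrFun hF t⟩

theorem exists_lift_circle_interval (c : C(unitInterval, UnitAddCircle)) :
    ∃ F : C(unitInterval, ℝ), ∀ t, (F t : UnitAddCircle) = c t := by
  obtain ⟨F, hF⟩ := exists_lift_circle
    (c.comp ⟨Set.projIcc (0 : ℝ) 1 zero_le_one, continuous_projIcc⟩)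
  exact ⟨F.comp ⟨Subtype.val, continuous_subtype_val⟩, fun t => by simp [hF]⟩

/-- The total change of the argument along a path in the circle. -/
noncomputable def argumentChange (c : C(unitInterval, UnitAddCircle)) : ℝ :=
  (exists_lift_circle_interval c).choose 1 - (exists_lift_circle_interval c).choose 0

/-- Two lifts that agree at `0` after a translation agree everywhere, so any lift may be used. -/
theorem argumentChange_eq (c : C(unitInterval, UnitAddCircle)) (F : C(unitInterval, ℝ))
    (hF : ∀ t, (F t : UnitAddCircle) = c t) : argumentChange c = F 1 - F 0 := by
  let G := (exists_lift_circle_interval c).choose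
  have hG' : ∀ t, (G t : UnitAddCircle) = c t := (exists_lift_circle_interval c).choose_spec
  let G' : C(unitInterval, ℝ) := ⟨fun t => G t - G 0 + F 0, by fun_prop⟩
  have : G' = F := by
    apply DFunLike.coe_injective
    refine (AddCircle.isCoveringMap_coe (1 : ℝ)).eq_of_comp_eq G'.continuous F.continuous ?_ 0 ?_
    · ext t
      simp [G', hF, hG']
    · simp [G']
  rw [← this]
  simp [G', argumentChange, G]


/-- One lift over the whole triangle restricts to lifts on all three faces, and the differences of
its values at the corners add up. -/
theorem argumentChange_triangle (c : C(stdSimplex ℝ (Fin 3), UnitAddCircle)) :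
    argumentChange (triangleFace c 2) + argumentChange (triangleFace c 0) =
      argumentChange (triangleFace c 1) := by
  let pr : ℝ → unitInterval := Set.projIcc (0 : ℝ) 1 zero_le_one
  have hpr : Continuous pr := continuous_projIcc
  have pr0 : pr 0 = 0 := Set.projIcc_left _
  have pr1 : pr 1 = 1 := Set.projIcc_right _
  have prt : ∀ t : unitInterval, pr t = t := fun t => Set.projIcc_val _ t
  -- The unit square is collapsed onto the triangle: its side `z.1 = 0` goes to the corner 0, and
  -- the sides `z.2 = 0`, `z.1 = 1`, `z.2 = 1` go to the faces 2, 0, 1. Clamping extends this to the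
  -- simply connected plane, where the lift exists.
  let r : C(ℝ × ℝ, stdSimplex ℝ (Fin 3)) :=
    ⟨fun z => ⟨![1 - (pr z.1 : ℝ), pr z.1 * (1 - pr z.2), pr z.1 * pr z.2], by
      constructor
      · intro i
        have := unitInterval.one_minus_nonneg (pr z.1)
        have := mul_nonneg (unitInterval.nonneg (pr z.1)) (unitInterval.one_minus_nonneg (pr z.2))
        have := mul_nonneg (unitInterval.nonneg (pr z.1)) (unitInterval.nonneg (pr z.2))
        fin_cases i <;> simp <;> first | assumption | exact unitInterval.le_one _
      · simp [Fin.sum_univ_three]; ring⟩, by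
      refine Continuous.subtype_mk (continuous_pi fun i => ?_) _
      fin_cases i <;> simp <;> fun_prop⟩
  obtain ⟨F, hF⟩ := exists_lift_circle (c.comp r)
  have key : ∀ (i : Fin 3) (u : C(unitInterval, ℝ × ℝ)),
      (∀ t, r (u t) = stdSimplex.map i.succAbove (stdSimplexHomeomorphUnitInterval.symm t)) →
      argumentChange (triangleFace c i) = F (u 1) - F (u 0) := by
    intro i u hu
    refine argumentChange_eq _ (F.comp u) fun t => ?_
    simp [hF, hu, triangleFace]
  have rz : ∀ z, ⇑(r z) = ![1 - (pr z.1 : ℝ), pr z.1 * (1 - pr z.2), pr z.1 * pr z.2] :=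
    fun _ => rfl
  have k2 := key 2 ⟨fun t => ((t : ℝ), 0), by fun_prop⟩ (by
    intro t; apply stdSimplex.ext; rw [stdSimplex_map_succAbove, rz]; simp [pr0, prt])
  have k0 := key 0 ⟨fun t => (1, (t : ℝ)), by fun_prop⟩ (by
    intro t; apply stdSimplex.ext; rw [stdSimplex_map_succAbove, rz]; simp [pr1, prt])
  have k1 := key 1 ⟨fun t => ((t : ℝ), 1), by fun_prop⟩ (by
    intro t; apply stdSimplex.ext; rw [stdSimplex_map_succAbove, rz]; simp [pr1, prt])
  -- On the collapsed side the lift covers a constant path, so its total change is zero.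
  have k3 : F (0, 1) = F (0, 0) := by
    let G : C(unitInterval, ℝ) := ⟨fun t => F (0, (t : ℝ)), by fun_prop⟩
    let G' : C(unitInterval, ℝ) := ⟨fun t => F (0, 0), by fun_prop⟩
    have hr : ∀ y, r (0, y) = r (0, 0) := by
      intro y; apply stdSimplex.ext; rw [rz, rz]; simp [pr0]
    have e : ∀ t, (G t : UnitAddCircle) = c (r (0, 0)) := fun t => by simp [G, hF, hr]
    have e' : ∀ t, (G' t : UnitAddCircle) = c (r (0, 0)) := fun t => by simp [G', hF]
    have h1 := argumentChange_eq (ContinuousMap.const _ (c (r (0, 0)))) G e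
    have h2 := argumentChange_eq (ContinuousMap.const _ (c (r (0, 0)))) G' e'
    simp [G'] at h2
    rw [h2] at h1
    simp [G] at h1
    linarith
  simp at k0 k1 k2
  rw [k0, k1, k2, k3]
  ring

/-- The linear functional on 1-chains modulo boundaries defined by the change of the argument of a
map to the circle. -/
theorem exists_argument_functional (f : C(X, UnitAddCircle)) :
    ∃ φ : (singularChains X).opcycles 1 →ₗ[ℝ] ℝ,
      ∀ σ, φ (simplexClass σ) = argumentChange (f.comp σ) := by
  let s := TopCat.toSSet.obj (TopCat.of X)
  -- The 1-chains are a coproduct over the 1-simplices, so the values on simplices are free. The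
  -- chosen preimage is harmless because `intervalSimplex` is injective.
  let φ₀ : (singularChains X).X 1 ⟶ ModuleCat.of ℝ ℝ :=
    Limits.Cofan.IsColimit.desc (s.isColimitChainComplexXCofan (ModuleCat.of ℝ ℝ) 1) fun z =>
      ModuleCat.ofHom ((argumentChange
        (f.comp (Function.surjInv intervalSimplex_surjective z))) • LinearMap.id)
  have h₀ : ∀ z, SSet.ιChainComplex s z ≫ φ₀ = ModuleCat.ofHom ((argumentChange
        (f.comp (Function.surjInv intervalSimplex_surjective z))) • LinearMap.id) := fun z =>
    Limits.Cofan.IsColimit.fac (s.isColimitChainComplexXCofan (ModuleCat.of ℝ ℝ) 1) _ z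
  have inj : Function.Injective (intervalSimplex (X := X)) := by
    intro a b hab
    have := (TopCat.toSSetObjEquiv _ _).symm.injective hab
    ext t
    have := DFunLike.congr_fun this (stdSimplexHomeomorphUnitInterval.symm t)
    simpa using this
  have h₁ : ∀ σ, SSet.ιChainComplex s (intervalSimplex σ) ≫ φ₀ =
      ModuleCat.ofHom ((argumentChange (f.comp σ)) • LinearMap.id) := fun σ => by
    rw [h₀, inj (Function.surjInv_eq intervalSimplex_surjective (intervalSimplex σ))]
  have hd : (singularChains X).d 2 1 ≫ φ₀ = 0 := by
    apply SSet.chainComplex_hom_ext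
    intro z
    obtain ⟨τ, rfl⟩ := (TopCat.toSSetObjEquiv (TopCat.of X) (.op ⦋2⦌)).symm.surjective z
    have e := argumentChange_triangle (f.comp τ)
    have hf : ∀ i, f.comp (triangleFace τ i) = triangleFace (f.comp τ) i := fun i => rfl
    rw [← Category.assoc, triangle_d, Preadditive.add_comp, Preadditive.sub_comp, h₁, h₁, h₁,
      hf, hf, hf, ← e, Limits.comp_zero]
    ext
    simp
  refine ⟨((singularChains X).descOpcycles φ₀ 2 (by simp) hd).hom, fun σ => ?_⟩
  have : SSet.ιChainComplex s (intervalSimplex σ) ≫ (singularChains X).pOpcycles 1 ≫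
      (singularChains X).descOpcycles φ₀ 2 (by simp) hd = 
      ModuleCat.ofHom ((argumentChange (f.comp σ)) • LinearMap.id) := by
    rw [HomologicalComplex.p_descOpcycles, h₁]
  have := congrArg (fun m => m.hom (1 : ℝ)) this
  refine Eq.trans this ?_
  simp

end Homology
end Origami

namespace Origami

/-! ### Coordinates on a square-tiled surface -/

section Coordinates

variable {n : ℕ} {h v : Equiv.Perm (Fin n)}

theorem Surface.mk_right (i : Fin n) (y : unitInterval) :
    Surface.mk h v i 1 y = Surface.mk h v (h i) 0 y := Quot.sound (Glue.right i y)

theorem Surface.mk_top (i : Fin n) (x : unitInterval) :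
    Surface.mk h v i x 1 = Surface.mk h v (v i) x 0 := Quot.sound (Glue.top i x)

theorem Surface.continuous_mk (i : Fin n) :
    Continuous fun z : unitInterval × unitInterval => Surface.mk h v i z.1 z.2 :=
  continuous_quot_mk.comp (by fun_prop : Continuous fun z : unitInterval × unitInterval => (i, z))

/-- A function on the surface given square by square. -/
def Surface.lift {α : Type*} (f : Fin n → unitInterval → unitInterval → α)
    (hr : ∀ i y, f i 1 y = f (h i) 0 y) (ht : ∀ i x, f i x 1 = f (v i) x 0) : Surface h v → α :=
  Quot.lift (fun z => f z.1 z.2.1 z.2.2) (by rintro _ _ (⟨i, y⟩ | ⟨i, x⟩) <;> simp [hr, ht])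

theorem Surface.continuous_lift {α : Type*} [TopologicalSpace α]
    {f : Fin n → unitInterval → unitInterval → α}
    (hr : ∀ i y, f i 1 y = f (h i) 0 y) (ht : ∀ i x, f i x 1 = f (v i) x 0)
    (hf : ∀ i, Continuous fun z : unitInterval × unitInterval => f i z.1 z.2) :
    Continuous (Surface.lift (h := h) (v := v) f hr ht) := by
  refine continuous_quot_lift _ ?_
  exact continuous_prod_of_discrete_left.2 hf

/-- The projection of the line to the unit interval. -/
noncomputable def clamp : ℝ → unitInterval := Set.projIcc 0 1 zero_le_one

theorem continuous_clamp : Continuous clamp := continuous_projIcc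

theorem coe_clamp {x : ℝ} (h0 : 0 ≤ x) (h1 : x ≤ 1) : (clamp x : ℝ) = x := by
  rw [clamp, Set.projIcc_of_mem _ ⟨h0, h1⟩]

@[simp] theorem clamp_coe (x : unitInterval) : clamp x = x := Set.projIcc_val _ x

@[simp] theorem clamp_zero : clamp 0 = 0 := Set.projIcc_left _

@[simp] theorem clamp_one : clamp 1 = 1 := Set.projIcc_right _

/-- The point with real coordinates `x`, `y` in the square `i`. -/
noncomputable def Surface.pt (h v : Equiv.Perm (Fin n)) (i : Fin n) (x y : ℝ) : Surface h v :=
  Surface.mk h v i (clamp x) (clamp y)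

theorem Surface.pt_right (i : Fin n) (y : ℝ) :
    Surface.pt h v i 1 y = Surface.pt h v (h i) 0 y := by
  simp [Surface.pt, Surface.mk_right]

theorem Surface.pt_top (i : Fin n) (x : ℝ) :
    Surface.pt h v i x 1 = Surface.pt h v (v i) x 0 := by
  simp [Surface.pt, Surface.mk_top]

theorem Surface.continuous_pt {X : Type*} [TopologicalSpace X] (i : Fin n) {f g : X → ℝ}
    (hf : Continuous f) (hg : Continuous g) : Continuous fun z => Surface.pt h v i (f z) (g z) :=
  (Surface.continuous_mk i).comp ((continuous_clamp.comp hf).prodMk (continuous_clamp.comp hg))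

theorem Surface.mk_eq_pt (i : Fin n) (x y : unitInterval) :
    Surface.mk h v i x y = Surface.pt h v i x y := by
  simp [Surface.pt]

theorem Surface.exists_mk (s : Surface h v) : ∃ i x y, s = Surface.mk h v i x y := by
  induction s using Quot.ind with
  | mk a => exact ⟨a.1, a.2.1, a.2.2, rfl⟩

theorem Surface.exists_pt (s : Surface h v) :
    ∃ i, ∃ x ∈ Set.Ico (0 : ℝ) 1, ∃ y ∈ Set.Ico (0 : ℝ) 1, s = Surface.pt h v i x y := by
  obtain ⟨i, x, y, rfl⟩ := s.exists_mk
  have h1 : ∃ i', ∃ x' ∈ Set.Ico (0 : ℝ) 1, Surface.mk h v i x y = Surface.pt h v i' x' y := by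
    by_cases hx : (x : ℝ) < 1
    · exact ⟨i, x, ⟨x.2.1, hx⟩, Surface.mk_eq_pt _ _ _⟩
    · obtain rfl : x = 1 := Subtype.ext (le_antisymm x.2.2 (not_lt.1 hx))
      exact ⟨h i, 0, by simp, by rw [Surface.mk_eq_pt, ← Surface.pt_right]; simp⟩
  obtain ⟨i', x', hx', e⟩ := h1
  rw [e]
  by_cases hy : (y : ℝ) < 1
  · exact ⟨i', x', hx', y, ⟨y.2.1, hy⟩, rfl⟩
  · have hy : (y : ℝ) = 1 := le_antisymm y.2.2 (not_lt.1 hy)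
    exact ⟨v i', x', hx', 0, by simp, by rw [hy, Surface.pt_top]⟩

theorem Surface.toTorus_pt (i : Fin n) {x y : ℝ} (hx : x ∈ Set.Icc (0 : ℝ) 1)
    (hy : y ∈ Set.Icc (0 : ℝ) 1) :
    (Surface.pt h v i x y).toTorus = ((x : UnitAddCircle), (y : UnitAddCircle)) := by
  change (((clamp x : ℝ) : UnitAddCircle), ((clamp y : ℝ) : UnitAddCircle)) = _
  rw [coe_clamp hx.1 hx.2, coe_clamp hy.1 hy.2]

/-- The vertices form the fibre over the origin, so a homeomorphism covering group homomorphisms of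
the torus in both directions preserves them automatically. Cone points need a separate check. -/
theorem mem_vertices_iff (s : Surface h v) : s ∈ vertices h v ↔ s.toTorus = 0 := by
  constructor
  · rintro ⟨i, rfl⟩
    simp [Surface.mk_eq_pt, Surface.toTorus_pt]
  · obtain ⟨i, x, hx, y, hy, rfl⟩ := s.exists_pt
    rw [Surface.toTorus_pt i (Set.Ico_subset_Icc_self hx) (Set.Ico_subset_Icc_self hy)]
    intro e
    have hx0 := congrArg Prod.fst e
    have hy0 := congrArg Prod.snd e
    simp only [Prod.fst_zero, Prod.snd_zero] at hx0 hy0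
    rw [AddCircle.coe_eq_zero_iff_of_mem_Ico (by simpa using hx)] at hx0
    rw [AddCircle.coe_eq_zero_iff_of_mem_Ico (by simpa using hy)] at hy0
    exact ⟨i, by simp [Surface.pt, hx0, hy0]⟩

theorem conePoints_subset_vertices : conePoints h v ⊆ vertices h v := by
  rintro _ ⟨i, -, rfl⟩
  exact ⟨i, rfl⟩

end Coordinates

/-! ### Affine homeomorphisms -/

section Transfer

variable {n : ℕ} {h v h' v' : Equiv.Perm (Fin n)} {p q p' q' : ℤ}

/-- A homeomorphism that is affine in the coordinates of the torus and maps the direction `(p, q)`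
to the direction `(p', q')`. -/
structure AffineHomeo (h v h' v' : Equiv.Perm (Fin n)) (p q p' q' : ℤ) where
  toHomeo : Surface h v ≃ₜ Surface h' v'
  linear : UnitAddCircle × UnitAddCircle →+ UnitAddCircle × UnitAddCircle
  linearInv : UnitAddCircle × UnitAddCircle →+ UnitAddCircle × UnitAddCircle
  toTorus_apply : ∀ s, (toHomeo s).toTorus = linear s.toTorus
  toTorus_symm_apply : ∀ s, (toHomeo.symm s).toTorus = linearInv s.toTorus
  linear_direction : ∀ t : ℝ, linear (((t * p : ℝ) : UnitAddCircle), ((t * q : ℝ) : UnitAddCircle))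
    = (((t * p' : ℝ) : UnitAddCircle), ((t * q' : ℝ) : UnitAddCircle))
  linearInv_direction : ∀ t : ℝ,
    linearInv (((t * p' : ℝ) : UnitAddCircle), ((t * q' : ℝ) : UnitAddCircle))
    = (((t * p : ℝ) : UnitAddCircle), ((t * q : ℝ) : UnitAddCircle))
  mem_conePoints : ∀ s, toHomeo s ∈ conePoints h' v' ↔ s ∈ conePoints h v

namespace AffineHomeo

/-- The inverse. -/
def symm (D : AffineHomeo h v h' v' p q p' q') : AffineHomeo h' v' h v p' q' p q where
  toHomeo := D.toHomeo.symm
  linear := D.linearInv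
  linearInv := D.linear
  toTorus_apply := D.toTorus_symm_apply
  toTorus_symm_apply := D.toTorus_apply
  linear_direction := D.linearInv_direction
  linearInv_direction := D.linear_direction
  mem_conePoints s := by rw [← D.mem_conePoints]; simp

/-- The composition. -/
def trans {h'' v'' : Equiv.Perm (Fin n)} {p'' q'' : ℤ} (D : AffineHomeo h v h' v' p q p' q')
    (D' : AffineHomeo h' v' h'' v'' p' q' p'' q'') : AffineHomeo h v h'' v'' p q p'' q'' where
  toHomeo := D.toHomeo.trans D'.toHomeo
  linear := D'.linear.comp D.linear
  linearInv := D.linearInv.comp D'.linearInv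
  toTorus_apply s := by simp [D.toTorus_apply, D'.toTorus_apply]
  toTorus_symm_apply s := by simp [D.toTorus_symm_apply, D'.toTorus_symm_apply]
  linear_direction t := by simp only [AddMonoidHom.comp_apply, D.linear_direction, D'.linear_direction]
  linearInv_direction t := by
    simp only [AddMonoidHom.comp_apply, D.linearInv_direction, D'.linearInv_direction]
  mem_conePoints s := by simp [D.mem_conePoints, D'.mem_conePoints]

theorem mem_vertices (D : AffineHomeo h v h' v' p q p' q') (s : Surface h v) :
    D.toHomeo s ∈ vertices h' v' ↔ s ∈ vertices h v := by
  rw [mem_vertices_iff, mem_vertices_iff]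
  constructor
  · intro e
    rw [← D.toHomeo.symm_apply_apply s, D.toTorus_symm_apply, e, map_zero]
  · intro e
    rw [D.toTorus_apply, e, map_zero]

variable {P : Set (Surface h v)} {P' : Set (Surface h' v')}

/-- The image of a closed leaf. -/
def mapLeaf (D : AffineHomeo h v h' v' p q p' q') (hP : ∀ s, D.toHomeo s ∈ P' ↔ s ∈ P)
    (w : ClosedLeaf P p q) : ClosedLeaf P' p' q' where
  toFun t := D.toHomeo (w.toFun t)
  period := w.period
  continuous_toFun := D.toHomeo.continuous.comp w.continuous_toFun
  avoids t := by rw [hP]; exact w.avoids t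
  straight t := by
    rw [D.toTorus_apply, D.toTorus_apply, w.straight t, map_add, D.linear_direction]
  period_pos := w.period_pos
  periodic t := by simp only [w.periodic t]
  minimal s hs hper := w.minimal s hs fun t => D.toHomeo.injective (hper t)

theorem mapLeaf_symm (D : AffineHomeo h v h' v' p q p' q') (hP : ∀ s, D.toHomeo s ∈ P' ↔ s ∈ P)
    (hP' : ∀ s, D.symm.toHomeo s ∈ P ↔ s ∈ P') (w : ClosedLeaf P' p' q') :
    D.mapLeaf hP (D.symm.mapLeaf hP' w) = w := by
  cases w
  simp [mapLeaf, symm]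

theorem mem_symm_iff (D : AffineHomeo h v h' v' p q p' q') (hP : ∀ s, D.toHomeo s ∈ P' ↔ s ∈ P)
    (s : Surface h' v') : D.symm.toHomeo s ∈ P ↔ s ∈ P' := by
  rw [← hP]; simp [symm]

theorem mapLeaf_surjective (D : AffineHomeo h v h' v' p q p' q')
    (hP : ∀ s, D.toHomeo s ∈ P' ↔ s ∈ P) : Function.Surjective (D.mapLeaf hP) := fun w =>
  ⟨_, D.mapLeaf_symm hP (D.mem_symm_iff hP) w⟩

/-- The isomorphism in homology. -/
noncomputable def homologyEquiv (D : AffineHomeo h v h' v' p q p' q') :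
    H1 (Surface h v) ≃ₗ[ℝ] H1 (Surface h' v') :=
  (((AlgebraicTopology.singularHomologyFunctor (ModuleCat ℝ) 1).obj (ModuleCat.of ℝ ℝ)).mapIso
    (TopCat.isoOfHomeo D.toHomeo)).toLinearEquiv

theorem homologyClass_mapLeaf (D : AffineHomeo h v h' v' p q p' q')
    (hP : ∀ s, D.toHomeo s ∈ P' ↔ s ∈ P) (w : ClosedLeaf P p q) :
    (D.mapLeaf hP w).homologyClass = D.homologyEquiv w.homologyClass :=
  (homologyMap_loopClass (D.toHomeo : C(Surface h v, Surface h' v')) w.loop).symm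

theorem finrank_waistSpan (D : AffineHomeo h v h' v' p q p' q')
    (hP : ∀ s, D.toHomeo s ∈ P' ↔ s ∈ P) :
    Module.finrank ℝ (waistSpan P' p' q') = Module.finrank ℝ (waistSpan P p q) := by
  have : waistSpan P' p' q' = (waistSpan P p q).map (D.homologyEquiv : _ →ₗ[ℝ] _) := by
    rw [waistSpan, waistSpan, Submodule.map_span, ← Set.range_comp,
      ← (D.mapLeaf_surjective hP).range_comp]
    congr 2
    ext w
    exact D.homologyClass_mapLeaf hP w
  rw [this]
  exact LinearEquiv.finrank_map_eq D.homologyEquiv _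

theorem image_closedLeafSet (D : AffineHomeo h v h' v' p q p' q')
    (hP : ∀ s, D.toHomeo s ∈ P' ↔ s ∈ P) :
    D.toHomeo '' closedLeafSet P p q = closedLeafSet P' p' q' := by
  ext s
  constructor
  · rintro ⟨_, ⟨w, t, rfl⟩, rfl⟩
    exact ⟨D.mapLeaf hP w, t, rfl⟩
  · rintro ⟨w, t, rfl⟩
    obtain ⟨w, rfl⟩ := D.mapLeaf_surjective hP w
    exact ⟨_, ⟨w, t, rfl⟩, rfl⟩

theorem cylinders_eq_image (D : AffineHomeo h v h' v' p q p' q')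
    (hP : ∀ s, D.toHomeo s ∈ P' ↔ s ∈ P) :
    cylinders P' p' q' = (fun C => D.toHomeo '' C) '' cylinders P p q := by
  ext C
  constructor
  · rintro ⟨x, hx, rfl⟩
    rw [← D.image_closedLeafSet hP] at hx ⊢
    obtain ⟨y, hy, rfl⟩ := hx
    exact ⟨_, ⟨y, hy, rfl⟩, D.toHomeo.image_connectedComponentIn hy⟩
  · rintro ⟨_, ⟨x, hx, rfl⟩, rfl⟩
    refine ⟨D.toHomeo x, ?_, ?_⟩
    · rw [← D.image_closedLeafSet hP]; exact Set.mem_image_of_mem _ hx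
    · rw [← D.image_closedLeafSet hP]; exact D.toHomeo.image_connectedComponentIn hx

end AffineHomeo

/-- Homological dimension two, and two pairs of homologous cylinders, whose waist curves have
period 6 and 2. -/
def HasTwoCylinderPairs (h v : Equiv.Perm (Fin n)) (p q : ℤ) : Prop :=
  Module.finrank ℝ (waistSpan (conePoints h v) p q) = 2 ∧
    Module.finrank ℝ (waistSpan (vertices h v) p q) = 2 ∧
    closure (⋃₀ cylinders (vertices h v) p q) = Set.univ ∧
    ∃ L₁ L₂ S₁ S₂ : Set (Surface h v),
      [L₁, L₂, S₁, S₂].Nodup ∧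
      cylinders (vertices h v) p q = {L₁, L₂, S₁, S₂} ∧
      (∀ w : ClosedLeaf (vertices h v) p q, w.toFun 0 ∈ L₁ ∪ L₂ → w.period = 6) ∧
      (∀ w : ClosedLeaf (vertices h v) p q, w.toFun 0 ∈ S₁ ∪ S₂ → w.period = 2) ∧
      (∀ w w' : ClosedLeaf (vertices h v) p q,
        w.toFun 0 ∈ L₁ ∪ L₂ → w'.toFun 0 ∈ L₁ ∪ L₂ → w.homologyClass = w'.homologyClass) ∧
      (∀ w w' : ClosedLeaf (vertices h v) p q,
        w.toFun 0 ∈ S₁ ∪ S₂ → w'.toFun 0 ∈ S₁ ∪ S₂ → w.homologyClass = w'.homologyClass)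

/-- An affine map changes Euclidean lengths but not periods with respect to the transported
direction vector; this is why the transported property speaks of periods. -/
theorem HasTwoCylinderPairs.map (D : AffineHomeo h v h' v' p q p' q')
    (H : HasTwoCylinderPairs h v p q) : HasTwoCylinderPairs h' v' p' q' := by
  obtain ⟨h1, h2, h3, L₁, L₂, S₁, S₂, hnd, hc, hL, hS, hL', hS'⟩ := H
  have hP := D.mem_vertices
  have mem : ∀ A B : Set (Surface h v), ∀ s,
      D.toHomeo s ∈ D.toHomeo '' A ∪ D.toHomeo '' B ↔ s ∈ A ∪ B := fun A B s => by
    rw [← Set.image_union, D.toHomeo.injective.mem_set_image]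
  refine ⟨(D.finrank_waistSpan D.mem_conePoints).trans h1, (D.finrank_waistSpan hP).trans h2, ?_,
    D.toHomeo '' L₁, D.toHomeo '' L₂, D.toHomeo '' S₁, D.toHomeo '' S₂, ?_, ?_, ?_, ?_, ?_, ?_⟩
  · rw [D.cylinders_eq_image hP, Set.sUnion_image, ← Set.image_iUnion₂, ← Set.sUnion_eq_biUnion,
      ← D.toHomeo.image_closure, h3, Set.image_univ, D.toHomeo.surjective.range_eq]
  · exact hnd.map (f := fun C => D.toHomeo '' C) D.toHomeo.injective.image_injective
  · rw [D.cylinders_eq_image hP, hc]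
    simp [Set.image_insert_eq]
  · intro w hw
    obtain ⟨w, rfl⟩ := D.mapLeaf_surjective hP w
    exact hL w ((mem _ _ _).1 hw)
  · intro w hw
    obtain ⟨w, rfl⟩ := D.mapLeaf_surjective hP w
    exact hS w ((mem _ _ _).1 hw)
  · intro w w' hw hw'
    obtain ⟨w, rfl⟩ := D.mapLeaf_surjective hP w
    obtain ⟨w', rfl⟩ := D.mapLeaf_surjective hP w'
    rw [D.homologyClass_mapLeaf, D.homologyClass_mapLeaf,
      hL' w w' ((mem _ _ _).1 hw) ((mem _ _ _).1 hw')]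
  · intro w w' hw hw'
    obtain ⟨w, rfl⟩ := D.mapLeaf_surjective hP w
    obtain ⟨w', rfl⟩ := D.mapLeaf_surjective hP w'
    rw [D.homologyClass_mapLeaf, D.homologyClass_mapLeaf,
      hS' w w' ((mem _ _ _).1 hw) ((mem _ _ _).1 hw')]

end Transfer
end Origami

namespace Origami

/-! ### Generating affine maps: relabelling, quarter turn, shear -/

section Generators

variable {n : ℕ} {h v h' v' : Equiv.Perm (Fin n)} (p q : ℤ)

theorem perm_apply_inv {α : Type*} (f : Equiv.Perm α) (x : α) : f (f⁻¹ x) = x :=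
  f.apply_symm_apply x

theorem perm_inv_apply {α : Type*} (f : Equiv.Perm α) (x : α) : f⁻¹ (f x) = x :=
  f.symm_apply_apply x

/-- It is enough to follow the lower left corners and to compare the fixed points of the two
commutators. -/
theorem mem_conePoints_iff_of_perm (Φ : Surface h v ≃ Surface h' v') (ρ : Equiv.Perm (Fin n))
    (h0 : ∀ i, Φ (Surface.mk h v i 0 0) = Surface.mk h' v' (ρ i) 0 0)
    (hc : ∀ i, (v' * h' * v'⁻¹ * h'⁻¹) (ρ i) = ρ i ↔ (v * h * v⁻¹ * h⁻¹) i = i) (s : Surface h v) :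
    Φ s ∈ conePoints h' v' ↔ s ∈ conePoints h v := by
  constructor
  · rintro ⟨j, hj, e⟩
    obtain ⟨i, rfl⟩ := ρ.surjective j
    rw [← h0] at e
    exact ⟨i, fun hi => hj ((hc i).2 hi), Φ.injective e⟩
  · rintro ⟨i, hi, rfl⟩
    exact ⟨ρ i, fun hj => hi ((hc i).1 hj), h0 i⟩

/-- Renaming the squares. -/
def relabelHomeo (σ : Equiv.Perm (Fin n)) (hh : ∀ i, σ (h i) = h' (σ i))
    (hv : ∀ i, σ (v i) = v' (σ i)) : Surface h v ≃ₜ Surface h' v' where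
  toFun := Surface.lift (fun i x y => Surface.mk h' v' (σ i) x y)
    (fun i y => by rw [Surface.mk_right, hh]) (fun i x => by rw [Surface.mk_top, hv])
  invFun := Surface.lift (fun i x y => Surface.mk h v (σ.symm i) x y)
    (fun i y => by rw [Surface.mk_right, ← σ.symm_apply_apply (h _), hh, σ.apply_symm_apply])
    (fun i x => by rw [Surface.mk_top, ← σ.symm_apply_apply (v _), hv, σ.apply_symm_apply])
  left_inv s := by
    obtain ⟨i, x, y, rfl⟩ := s.exists_mk
    exact congrArg (fun j => Surface.mk h v j x y) (σ.symm_apply_apply i)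
  right_inv s := by
    obtain ⟨i, x, y, rfl⟩ := s.exists_mk
    exact congrArg (fun j => Surface.mk h' v' j x y) (σ.apply_symm_apply i)
  continuous_toFun := Surface.continuous_lift _ _ fun _ => Surface.continuous_mk _
  continuous_invFun := Surface.continuous_lift _ _ fun _ => Surface.continuous_mk _

/-- Renaming the squares, as an affine homeomorphism. -/
def relabel (σ : Equiv.Perm (Fin n)) (hh : ∀ i, σ (h i) = h' (σ i))
    (hv : ∀ i, σ (v i) = v' (σ i)) : AffineHomeo h v h' v' p q p q where
  toHomeo := relabelHomeo σ hh hv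
  linear := AddMonoidHom.id _
  linearInv := AddMonoidHom.id _
  toTorus_apply s := by obtain ⟨i, x, y, rfl⟩ := s.exists_mk; rfl
  toTorus_symm_apply s := by obtain ⟨i, x, y, rfl⟩ := s.exists_mk; rfl
  linear_direction t := rfl
  linearInv_direction t := rfl
  mem_conePoints := mem_conePoints_iff_of_perm (relabelHomeo σ hh hv).toEquiv σ (fun i => rfl) <| by
    have hh' : ∀ i, h'⁻¹ (σ i) = σ (h⁻¹ i) := fun i => by
      rw [Equiv.Perm.inv_eq_iff_eq, ← hh, perm_apply_inv]
    have hv' : ∀ i, v'⁻¹ (σ i) = σ (v⁻¹ i) := fun i => by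
      rw [Equiv.Perm.inv_eq_iff_eq, ← hv, perm_apply_inv]
    intro i
    simp only [Equiv.Perm.mul_apply, hh', hv', ← hh, ← hv, σ.injective.eq_iff]

/-- The rotation by a quarter turn. -/
def rotationHomeo (h v : Equiv.Perm (Fin n)) : Surface h v ≃ₜ Surface v⁻¹ h where
  toFun := Surface.lift (fun i x y => Surface.mk v⁻¹ h i (unitInterval.symm y) x)
    (fun i y => by rw [Surface.mk_top])
    (fun i x => by
      rw [unitInterval.symm_one, unitInterval.symm_zero, Surface.mk_right,
        perm_inv_apply])
  invFun := Surface.lift (fun i x y => Surface.mk h v i y (unitInterval.symm x))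
    (fun i x => by
      rw [unitInterval.symm_one, unitInterval.symm_zero, Surface.mk_top,
        perm_apply_inv])
    (fun i y => by rw [Surface.mk_right])
  left_inv s := by
    obtain ⟨i, x, y, rfl⟩ := s.exists_mk
    exact congrArg (fun z => Surface.mk h v i x z) (unitInterval.symm_symm y)
  right_inv s := by
    obtain ⟨i, x, y, rfl⟩ := s.exists_mk
    exact congrArg (fun z => Surface.mk v⁻¹ h i z y) (unitInterval.symm_symm x)
  continuous_toFun := Surface.continuous_lift _ _ fun i => (Surface.continuous_mk i).comp
    (by fun_prop : Continuous fun z : unitInterval × unitInterval => (unitInterval.symm z.2, z.1))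
  continuous_invFun := Surface.continuous_lift _ _ fun i => (Surface.continuous_mk i).comp
    (by fun_prop : Continuous fun z : unitInterval × unitInterval => (z.2, unitInterval.symm z.1))

/-- The rotation by a quarter turn, as an affine homeomorphism. -/
def rotation (h v : Equiv.Perm (Fin n)) : AffineHomeo h v v⁻¹ h p q (-q) p where
  toHomeo := rotationHomeo h v
  linear := (-AddMonoidHom.snd _ _).prod (AddMonoidHom.fst _ _)
  linearInv := (AddMonoidHom.snd _ _).prod (-AddMonoidHom.fst _ _)
  toTorus_apply s := by
    obtain ⟨i, x, y, rfl⟩ := s.exists_mk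
    change (((1 - y : ℝ) : UnitAddCircle), _) = (-((y : ℝ) : UnitAddCircle), _)
    rw [AddCircle.coe_sub, AddCircle.coe_period, zero_sub]
    rfl
  toTorus_symm_apply s := by
    obtain ⟨i, x, y, rfl⟩ := s.exists_mk
    change (_, ((1 - x : ℝ) : UnitAddCircle)) = (_, -((x : ℝ) : UnitAddCircle))
    rw [AddCircle.coe_sub, AddCircle.coe_period, zero_sub]
    rfl
  linear_direction t := by simp
  linearInv_direction t := by simp
  -- The turn sends the lower left corner of `i` to its lower right corner, which is the lower left
  -- corner of the new right neighbour `v⁻¹ i`.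
  mem_conePoints := mem_conePoints_iff_of_perm (rotationHomeo h v).toEquiv v⁻¹
    (fun i => by
      change Surface.mk v⁻¹ h i (unitInterval.symm 0) 0 = _
      rw [unitInterval.symm_zero, Surface.mk_right])
    (fun i => by
      simp only [Equiv.Perm.mul_apply, inv_inv, perm_apply_inv]
      rw [Equiv.Perm.eq_inv_iff_eq])

/-- The horizontal shear on a square. -/
noncomputable def shearFun (h v : Equiv.Perm (Fin n)) (i : Fin n) (x y : ℝ) : Surface h v :=
  if x + y ≤ 1 then Surface.pt h v i (x + y) y else Surface.pt h v (h i) (x + y - 1) y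

/-- The inverse horizontal shear on a square. -/
noncomputable def unshearFun (h v : Equiv.Perm (Fin n)) (i : Fin n) (x y : ℝ) : Surface h v :=
  if y ≤ x then Surface.pt h v i (x - y) y else Surface.pt h v (h⁻¹ i) (x - y + 1) y

/-- Both branches agree on the line `x + y = 1`, by the gluing of the right side of `i`. -/
theorem shearFun_of_ge {i : Fin n} {x y : ℝ} (hxy : 1 ≤ x + y) :
    shearFun h v i x y = Surface.pt h v (h i) (x + y - 1) y := by
  rcases hxy.eq_or_lt with e | e
  · rw [shearFun, if_pos e.ge, ← e, Surface.pt_right, sub_self]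
  · rw [shearFun, if_neg e.not_ge]

theorem unshearFun_of_ge {i : Fin n} {x y : ℝ} (hxy : x ≤ y) :
    unshearFun h v i x y = Surface.pt h v (h⁻¹ i) (x - y + 1) y := by
  rcases hxy.eq_or_lt with e | e
  · rw [unshearFun, if_pos e.ge, e, sub_self, zero_add, Surface.pt_right,
      perm_apply_inv]
  · rw [unshearFun, if_neg e.not_ge]

theorem continuous_shearFun (i : Fin n) :
    Continuous fun z : ℝ × ℝ => shearFun h v i z.1 z.2 :=
  Continuous.if_le (Surface.continuous_pt i (by fun_prop) (by fun_prop))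
    (Surface.continuous_pt _ (by fun_prop) (by fun_prop)) (by fun_prop) (by fun_prop)
    fun z hz => by rw [hz, Surface.pt_right, sub_self]

theorem continuous_unshearFun (i : Fin n) :
    Continuous fun z : ℝ × ℝ => unshearFun h v i z.1 z.2 :=
  Continuous.if_le (Surface.continuous_pt i (by fun_prop) (by fun_prop))
    (Surface.continuous_pt _ (by fun_prop) (by fun_prop)) (by fun_prop) (by fun_prop)
    fun z hz => by rw [hz, sub_self, zero_add, Surface.pt_right, perm_apply_inv]

/-- The horizontal shear. -/
noncomputable def shearMap (h v : Equiv.Perm (Fin n)) : Surface h v → Surface h (v * h⁻¹) :=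
  -- The sheared top side of `i` lies on top of `h i`, and it must still lead to `v i`. This forces
  -- the new vertical permutation `v * h⁻¹`.
  Surface.lift (fun i x y => shearFun h (v * h⁻¹) i x y)
    (fun i y => by
      rw [shearFun_of_ge (by simpa using y.2.1), shearFun,
        if_pos (by simpa using y.2.2)]
      simp)
    (fun i x => by
      rw [shearFun_of_ge (by simpa using x.2.1), shearFun,
        if_pos (by simpa using x.2.2)]
      simp [Surface.pt_top])

/-- The inverse horizontal shear. -/
noncomputable def unshearMap (h v : Equiv.Perm (Fin n)) : Surface h (v * h⁻¹) → Surface h v :=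
  Surface.lift (fun i x y => unshearFun h v i x y)
    (fun i y => by
      rw [unshearFun_of_ge (x := ((0 : unitInterval) : ℝ)) (by simpa using y.2.1), unshearFun,
        if_pos (by simpa using y.2.2)]
      simp [sub_eq_neg_add])
    (fun i x => by
      rw [unshearFun_of_ge (by simpa using x.2.2), unshearFun,
        if_pos (by simpa using x.2.1)]
      simp [Surface.pt_top])

theorem shearMap_pt (i : Fin n) {x y : ℝ} (hx : x ∈ Set.Icc (0 : ℝ) 1) (hy : y ∈ Set.Icc (0 : ℝ) 1) :
    shearMap h v (Surface.pt h v i x y) = shearFun h (v * h⁻¹) i x y := by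
  change shearFun h (v * h⁻¹) i (clamp x) (clamp y) = _
  rw [coe_clamp hx.1 hx.2, coe_clamp hy.1 hy.2]

theorem unshearMap_pt (i : Fin n) {x y : ℝ} (hx : x ∈ Set.Icc (0 : ℝ) 1)
    (hy : y ∈ Set.Icc (0 : ℝ) 1) :
    unshearMap h v (Surface.pt h (v * h⁻¹) i x y) = unshearFun h v i x y := by
  change unshearFun h v i (clamp x) (clamp y) = _
  rw [coe_clamp hx.1 hx.2, coe_clamp hy.1 hy.2]

theorem unshearMap_shearMap (s : Surface h v) : unshearMap h v (shearMap h v s) = s := by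
  obtain ⟨i, x, ⟨hx0, hx1⟩, y, ⟨hy0, hy1⟩, rfl⟩ := s.exists_pt
  rw [shearMap_pt i ⟨hx0, hx1.le⟩ ⟨hy0, hy1.le⟩]
  by_cases hxy : x + y ≤ 1
  · rw [shearFun, if_pos hxy, unshearMap_pt i ⟨by linarith, hxy⟩ ⟨hy0, hy1.le⟩, unshearFun,
      if_pos (by linarith), add_sub_cancel_right]
  · rw [shearFun, if_neg hxy, unshearMap_pt _ ⟨by linarith, by linarith⟩ ⟨hy0, hy1.le⟩,
      unshearFun_of_ge (by linarith), perm_inv_apply]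
    congr 1; ring

theorem shearMap_unshearMap (s : Surface h (v * h⁻¹)) : shearMap h v (unshearMap h v s) = s := by
  obtain ⟨i, x, ⟨hx0, hx1⟩, y, ⟨hy0, hy1⟩, rfl⟩ := s.exists_pt
  rw [unshearMap_pt i ⟨hx0, hx1.le⟩ ⟨hy0, hy1.le⟩]
  by_cases hxy : y ≤ x
  · rw [unshearFun, if_pos hxy, shearMap_pt i ⟨by linarith, by linarith⟩ ⟨hy0, hy1.le⟩, shearFun,
      if_pos (by linarith), sub_add_cancel]
  · rw [unshearFun, if_neg hxy, shearMap_pt _ ⟨by linarith, by linarith⟩ ⟨hy0, hy1.le⟩,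
      shearFun_of_ge (by linarith), perm_apply_inv]
    congr 1; ring

/-- The horizontal shear as a homeomorphism. -/
noncomputable def shearHomeo (h v : Equiv.Perm (Fin n)) : Surface h v ≃ₜ Surface h (v * h⁻¹) where
  toFun := shearMap h v
  invFun := unshearMap h v
  left_inv := unshearMap_shearMap
  right_inv := shearMap_unshearMap
  continuous_toFun := Surface.continuous_lift _ _ fun i => (continuous_shearFun i).comp
    (by fun_prop : Continuous fun z : unitInterval × unitInterval => ((z.1 : ℝ), (z.2 : ℝ)))
  continuous_invFun := Surface.continuous_lift _ _ fun i => (continuous_unshearFun i).comp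
    (by fun_prop : Continuous fun z : unitInterval × unitInterval => ((z.1 : ℝ), (z.2 : ℝ)))

/-- The horizontal shear as an affine homeomorphism. -/
noncomputable def shear (h v : Equiv.Perm (Fin n)) :
    AffineHomeo h v h (v * h⁻¹) p q (p + q) q where
  toHomeo := shearHomeo h v
  linear := AddMonoidHom.prod (AddMonoidHom.fst _ _ + AddMonoidHom.snd _ _) (AddMonoidHom.snd _ _)
  linearInv := AddMonoidHom.prod (AddMonoidHom.fst _ _ - AddMonoidHom.snd _ _) (AddMonoidHom.snd _ _)
  toTorus_apply s := by
    obtain ⟨i, x, ⟨hx0, hx1⟩, y, ⟨hy0, hy1⟩, rfl⟩ := s.exists_pt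
    change (shearMap h v (Surface.pt h v i x y)).toTorus = _
    rw [shearMap_pt i ⟨hx0, hx1.le⟩ ⟨hy0, hy1.le⟩, Surface.toTorus_pt i ⟨hx0, hx1.le⟩ ⟨hy0, hy1.le⟩,
      shearFun]
    split_ifs with hxy
    · rw [Surface.toTorus_pt i ⟨by linarith, hxy⟩ ⟨hy0, hy1.le⟩]
      simp
    · rw [Surface.toTorus_pt _ ⟨by linarith, by linarith⟩ ⟨hy0, hy1.le⟩]
      simp
  toTorus_symm_apply s := by
    obtain ⟨i, x, ⟨hx0, hx1⟩, y, ⟨hy0, hy1⟩, rfl⟩ := s.exists_pt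
    change (unshearMap h v (Surface.pt h (v * h⁻¹) i x y)).toTorus = _
    rw [unshearMap_pt i ⟨hx0, hx1.le⟩ ⟨hy0, hy1.le⟩,
      Surface.toTorus_pt i ⟨hx0, hx1.le⟩ ⟨hy0, hy1.le⟩, unshearFun]
    split_ifs with hxy
    · rw [Surface.toTorus_pt i ⟨by linarith, by linarith⟩ ⟨hy0, hy1.le⟩]
      simp
    · rw [Surface.toTorus_pt _ ⟨by linarith, by linarith⟩ ⟨hy0, hy1.le⟩]
      simp
  linear_direction t := by simp [mul_add]
  linearInv_direction t := by simp [mul_add]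
  mem_conePoints := mem_conePoints_iff_of_perm (shearHomeo h v).toEquiv 1
    (fun i => by
      have := shearMap_pt (h := h) (v := v) (x := 0) (y := 0) i (by simp) (by simp)
      simp [Surface.pt, shearFun] at this
      exact this)
    (fun i => by simp)

end Generators

/-! ### The symmetries of the origami -/

theorem hO_apply (i : Fin 16) : hO i = ![15, 2, 3, 4, 5, 6, 1, 12, 7, 8, 9, 10, 11, 14, 13, 0] i := by
  revert i; decide

theorem vO_apply (i : Fin 16) : vO i = ![14, 11, 0, 9, 8, 15, 12, 1, 4, 3, 6, 5, 2, 7, 10, 13] i := by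
  revert i; decide

/-- The permutation of the squares induced by the rotation. -/
def rotationPerm : Equiv.Perm (Fin 16) where
  toFun := ![4, 11, 5, 15, 13, 7, 1, 10, 14, 0, 2, 12, 6, 9, 3, 8]
  invFun := ![9, 6, 10, 14, 0, 2, 12, 5, 15, 13, 7, 1, 11, 4, 8, 3]
  left_inv := by intro i; revert i; decide
  right_inv := by intro i; revert i; decide

/-- The permutation of the squares induced by the shear. -/
def shearPerm : Equiv.Perm (Fin 16) where
  toFun := ![15, 3, 4, 5, 6, 1, 2, 10, 11, 12, 7, 8, 9, 13, 14, 0]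
  invFun := ![15, 5, 6, 1, 2, 3, 4, 10, 11, 12, 7, 8, 9, 13, 14, 0]
  left_inv := by intro i; revert i; decide
  right_inv := by intro i; revert i; decide

theorem HasTwoCylinderPairs.rotate {p q : ℤ} (H : HasTwoCylinderPairs hO vO p q) :
    HasTwoCylinderPairs hO vO (-q) p := by
  refine (H.map (rotation p q hO vO)).map (relabel _ _ rotationPerm ?_ ?_)
  · intro i
    -- Writing the square as `vO i` removes the inverse, so that only the tables have to be compared
    -- on 16 squares.
    obtain ⟨i, rfl⟩ := vO.surjective i
    rw [perm_inv_apply, hO_apply, vO_apply]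
    revert i; decide
  · intro i
    rw [hO_apply, vO_apply]
    revert i; decide

/-- The affine self-homeomorphism whose derivative is the shear. -/
noncomputable def shearSelf (p q : ℤ) : AffineHomeo hO vO hO vO p q (p + q) q :=
  (shear p q hO vO).trans (relabel _ _ shearPerm
    (by intro i; rw [hO_apply, hO_apply]; revert i; decide)
    (by
      intro i
      obtain ⟨i, rfl⟩ := hO.surjective i
      rw [Equiv.Perm.mul_apply, perm_inv_apply, hO_apply, vO_apply, vO_apply]
      revert i; decide))

theorem HasTwoCylinderPairs.shear_iff {p q : ℤ} (k : ℤ) :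
    HasTwoCylinderPairs hO vO (p + k * q) q ↔ HasTwoCylinderPairs hO vO p q := by
  have step : ∀ p, HasTwoCylinderPairs hO vO (p + q) q ↔ HasTwoCylinderPairs hO vO p q := fun p =>
    ⟨fun H => H.map (shearSelf p q).symm, fun H => H.map (shearSelf p q)⟩
  induction k using Int.induction_on with
  | zero => simp
  | succ k ih => refine Iff.trans ?_ ((step (p + k * q)).trans ih); ring_nf
  | pred k ih => refine Iff.trans (step (p + (-k - 1) * q)).symm (Iff.trans ?_ ih); ring_nf

/-- This is the Euclidean algorithm: shears reduce `p` modulo `q`, and a quarter turn exchanges the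
coordinates up to sign, with `|q|` decreasing. -/
theorem HasTwoCylinderPairs.of_horizontal (H : HasTwoCylinderPairs hO vO 1 0) :
    ∀ (m : ℕ) (p q : ℤ), q.natAbs = m → IsCoprime p q → HasTwoCylinderPairs hO vO p q := by
  intro m
  induction m using Nat.strong_induction_on with
  | _ m ih =>
    intro p q hm hpq
    by_cases hq : q = 0
    · subst hq
      rw [isCoprime_zero_right, Int.isUnit_iff] at hpq
      rcases hpq with rfl | rfl
      · exact H
      -- The direction `(-1, 0)` is reached by a half turn.
      · simpa using H.rotate.rotate
    · have e : p = p % q + (p / q) * q := by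
        rw [mul_comm]; exact (Int.emod_add_mul_ediv p q).symm
      rw [e] at hpq ⊢
      rw [HasTwoCylinderPairs.shear_iff]
      have hpq' : IsCoprime (p % q) q := by simpa using hpq
      have := (ih (-(p % q)).natAbs (by
        rw [← hm, Int.natAbs_neg]
        have := Int.emod_nonneg p hq
        have := Int.emod_lt p hq
        omega)
        q (-(p % q)) rfl hpq'.symm.neg_right).rotate
      simpa using this

end Origami

namespace Origami

/-! ### Horizontal leaves -/

section Horizontal

variable {n : ℕ} {h v : Equiv.Perm (Fin n)}

theorem Surface.lift_pt {α : Type*} {f : Fin n → unitInterval → unitInterval → α}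
    (hr : ∀ i y, f i 1 y = f (h i) 0 y) (ht : ∀ i x, f i x 1 = f (v i) x 0) (i : Fin n) (x y : ℝ) :
    Surface.lift f hr ht (Surface.pt h v i x y) = f i (clamp x) (clamp y) := rfl

/-- On each horizontal line the edges are separated by continuous functions. -/
theorem exists_edge_function (h v : Equiv.Perm (Fin n)) (i : Fin n) {y : ℝ}
    (hy : y ∈ Set.Ico (0 : ℝ) 1) :
    ∃ F : Surface h v → ℝ, Continuous F ∧ ∃ κ : ℝ, 0 < κ ∧ ∀ j, ∀ x ∈ Set.Icc (0 : ℝ) 1,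
      F (Surface.pt h v j x y) = if j = i then κ * (x * (1 - x)) else 0 := by
  rcases hy.1.eq_or_lt with rfl | hy0
  · refine ⟨Surface.lift (fun j x y => x * (1 - x) *
      ((if j = i then 1 else 0) * max 0 (1 - 2 * (y : ℝ)) +
        (if v j = i then 1 else 0) * max 0 (2 * (y : ℝ) - 1)))
      (fun j y => by simp) (fun j x => by norm_num), Surface.continuous_lift _ _ fun j => by fun_prop,
      1, one_pos, fun j x hx => ?_⟩
    rw [Surface.lift_pt, coe_clamp hx.1 hx.2]
    split_ifs <;> simp
  · refine ⟨Surface.lift (fun j x y => (if j = i then 1 else 0) *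
        ((y * (1 - y)) * (x * (1 - x)) : ℝ)) (fun j y => by simp) (fun j x => by simp),
      Surface.continuous_lift _ _ fun j => by fun_prop,
      y * (1 - y), mul_pos hy0 (by linarith [hy.2]), fun j x hx => ?_⟩
    rw [Surface.lift_pt, coe_clamp hx.1 hx.2, coe_clamp hy.1 hy.2.le]
    split_ifs <;> simp

/-- On a horizontal line without singularity the vertical edges are separated by continuous
functions. -/
theorem exists_vertex_function (h v : Equiv.Perm (Fin n)) (i : Fin n) {y : ℝ}
    (hy : y ∈ Set.Ico (0 : ℝ) 1) (hi : y ≠ 0 ∨ (v * h * v⁻¹ * h⁻¹) i = i) :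
    ∃ F : Surface h v → ℝ, Continuous F ∧ ∃ κ : ℝ, 0 < κ ∧ ∀ j, ∀ x ∈ Set.Icc (0 : ℝ) 1,
      F (Surface.pt h v j x y) =
        κ * ((if j = i then 1 else 0) * (1 - x) + (if h j = i then 1 else 0) * x) := by
  by_cases hy0 : y = 0
  · subst hy0
    -- The function is a tent around the left edge of `i`, spread over `i` and the square to its
    -- left. At height 0 it must also be matched along the tops of the squares below, which works
    -- because `v` and `h` commute around a regular corner.
    have hc : (v * h * v⁻¹ * h⁻¹) i = i := by simpa using hi
    have comm : ∀ j, v (h j) = i ↔ h (v j) = i := by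
      simp only [Equiv.Perm.mul_apply] at hc
      intro j
      constructor
      · intro e
        have : h⁻¹ i = v j := by
          rw [← Equiv.Perm.inv_eq_iff_eq]
          apply h.injective
          apply v.injective
          rw [hc, e]
        rw [← this, perm_apply_inv]
      · rintro rfl
        simpa using hc
    refine ⟨Surface.lift (fun j x y =>
      ((if j = i then 1 else 0) * (1 - x) + (if h j = i then 1 else 0) * x) * (1 - (y : ℝ)) +
      ((if v j = i then 1 else 0) * (1 - x) + (if v (h j) = i then 1 else 0) * x) * (y : ℝ))
      (fun j y => by simp) (fun j x => by simp [comm]),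
      Surface.continuous_lift _ _ fun j => by fun_prop,
      1, one_pos, fun j x hx => ?_⟩
    rw [Surface.lift_pt, coe_clamp hx.1 hx.2]
    simp
  · have hpos : 0 < y := lt_of_le_of_ne hy.1 (Ne.symm hy0)
    refine ⟨Surface.lift (fun j x y => y * (1 - y) *
      ((if j = i then 1 else 0) * (1 - x) + (if h j = i then 1 else 0) * x : ℝ))
      (fun j y => by simp) (fun j x => by simp), Surface.continuous_lift _ _ fun j => by fun_prop,
      y * (1 - y), mul_pos hpos (by linarith [hy.2]), fun j x hx => ?_⟩
    rw [Surface.lift_pt, coe_clamp hx.1 hx.2, coe_clamp hy.1 hy.2.le]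

theorem fract_mem_Icc (s : ℝ) : Int.fract s ∈ Set.Icc (0 : ℝ) 1 :=
  ⟨Int.fract_nonneg s, (Int.fract_lt_one s).le⟩

theorem floor_of_mem_Ioo {m : ℤ} {s : ℝ} (hs : s ∈ Set.Ioo (m : ℝ) (m + 1)) : ⌊s⌋ = m :=
  Int.floor_eq_iff.2 ⟨hs.1.le, hs.2⟩

theorem fract_of_mem_Ioo {m : ℤ} {s : ℝ} (hs : s ∈ Set.Ioo (m : ℝ) (m + 1)) :
    Int.fract s = s - m := by
  rw [← Int.self_sub_floor, floor_of_mem_Ioo hs]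

/-- Between two vertical edges an edge function is positive on one square only, so the index is
locally constant there. -/
theorem index_const {g : ℝ → Surface h v} (hg : Continuous g) {j : ℝ → Fin n} {y : ℝ}
    (hy : y ∈ Set.Ico (0 : ℝ) 1) (hj : ∀ s, g s = Surface.pt h v (j s) (Int.fract s) y) (m : ℤ)
    {s s' : ℝ} (hs : s ∈ Set.Ioo (m : ℝ) (m + 1)) (hs' : s' ∈ Set.Ioo (m : ℝ) (m + 1)) :
    j s = j s' := by
  refine isPreconnected_Ioo.constant (fun r hr => ContinuousAt.continuousWithinAt ?_) hs hs'
  obtain ⟨F, hF, κ, hκ, hFj⟩ := exists_edge_function h v (j r) hy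
  have hpos : 0 < F (g r) := by
    rw [hj, hFj _ _ (fract_mem_Icc r), if_pos rfl, fract_of_mem_Ioo hr]
    have h1 := sub_pos.2 hr.1
    have h2 := sub_pos.2 hr.2
    exact mul_pos hκ (mul_pos h1 (by linarith))
  have ev : ∀ᶠ r' in nhds r, 0 < F (g r') :=
    (hF.comp hg).continuousAt.eventually (lt_mem_nhds hpos)
  refine Filter.EventuallyEq.continuousAt (y := j r) (ev.mono fun r' hr' => ?_)
  by_contra hne
  rw [hj, hFj _ _ (fract_mem_Icc r'), if_neg hne] at hr'
  exact lt_irrefl _ hr'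

/-- At an integer time the path crosses a vertical edge. If the crossing is not a cone point, the
tent function at that edge has positive value there, and continuity identifies the squares on both
sides. -/
theorem index_step {g : ℝ → Surface h v} (hg : Continuous g) {j : ℝ → Fin n} {y : ℝ}
    (hy : y ∈ Set.Ico (0 : ℝ) 1) (hj : ∀ s, g s = Surface.pt h v (j s) (Int.fract s) y)
    (hc : ∀ s, g s ∉ conePoints h v) (m : ℤ)
    {s : ℝ} (hs : s ∈ Set.Ioo (m : ℝ) (m + 1)) : j s = j m ∧ h (j s) = j (m + 1) := by
  have regular : ∀ k : ℤ, y ≠ 0 ∨ (v * h * v⁻¹ * h⁻¹) (j k) = j k := by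
    intro k
    by_contra! hne
    apply hc k
    refine ⟨j k, hne.2, ?_⟩
    rw [hj, hne.1]
    simp [Surface.pt]
  -- The tent function is affine on the open interval; its values at the two ends are compared with
  -- the value at the edge itself.
  have key : ∀ k : ℤ, (k : ℝ) ∈ Set.Icc (m : ℝ) (m + 1) →
      (1 : ℝ) = (if j s = j k then 1 else 0) * (1 - (k - m)) +
        (if h (j s) = j k then 1 else 0) * (k - m) := by
    intro k hk
    obtain ⟨F, hF, κ, hκ, hFj⟩ := exists_vertex_function h v (j k) hy (regular k)
    have e : Set.EqOn (F ∘ g) (fun r => κ * ((if j s = j k then 1 else 0) * (1 - (r - m)) +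
        (if h (j s) = j k then 1 else 0) * (r - m))) (Set.Ioo (m : ℝ) (m + 1)) := by
      intro r hr
      simp only [Function.comp]
      rw [hj, hFj _ _ (fract_mem_Icc r), fract_of_mem_Ioo hr, index_const hg hy hj m hr hs]
    have e' := e.closure (hF.comp hg) (by fun_prop)
    rw [closure_Ioo (by simp)] at e'
    have e'' := e' hk
    simp only [Function.comp] at e''
    rw [hj, hFj _ _ (fract_mem_Icc _)] at e''
    have := mul_left_cancel₀ hκ.ne' e''
    simpa using this
  have k0 := key m (by simp)
  have k1 := key (m + 1) (by simp)
  push_cast at k1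
  simp only [sub_self, sub_zero, mul_one, mul_zero, add_zero, add_sub_cancel_left, zero_add] at k0 k1
  constructor
  · by_contra hne; simp [hne] at k0
  · by_contra hne; simp [hne] at k1

/-- The horizontal path at height `y` that starts at the left side of the square `i`. -/
noncomputable def rowPath (h v : Equiv.Perm (Fin n)) (i : Fin n) (y s : ℝ) : Surface h v :=
  Surface.pt h v ((h ^ ⌊s⌋) i) (Int.fract s) y

theorem eq_rowPath {g : ℝ → Surface h v} (hg : Continuous g) {j : ℝ → Fin n} {y : ℝ}
    (hy : y ∈ Set.Ico (0 : ℝ) 1) (hj : ∀ s, g s = Surface.pt h v (j s) (Int.fract s) y)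
    (hc : ∀ s, g s ∉ conePoints h v) (s : ℝ) : g s = rowPath h v (j 0) y s := by
  have half : ∀ m : ℤ, (m : ℝ) + 1 / 2 ∈ Set.Ioo (m : ℝ) (m + 1) := fun m =>
    ⟨by linarith, by linarith⟩
  have step : ∀ m : ℤ, j (m + 1) = h (j m) := fun m => by
    have := index_step hg hy hj hc m (half m)
    rw [← this.2, ← this.1]
  have hint : ∀ m : ℤ, j m = (h ^ m) (j 0) := by
    intro m
    induction m using Int.induction_on with
    | zero => simp
    | succ k ih =>
      push_cast at ih ⊢
      have := step k
      push_cast at this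
      rw [this, ih, add_comm, zpow_one_add]; rfl
    | pred k ih =>
      have := step (-k - 1)
      push_cast at this ih ⊢
      rw [sub_add_cancel, ih] at this
      apply h.injective
      rw [← this, sub_eq_neg_add, zpow_add, zpow_neg_one, Equiv.Perm.mul_apply, perm_apply_inv]
  rw [hj, rowPath, ← hint]
  congr 1
  rcases eq_or_lt_of_le (Int.floor_le s) with e | e
  · rw [e]
  · exact (index_step hg hy hj hc ⌊s⌋ ⟨e, Int.lt_floor_add_one s⟩).1

variable {P : Set (Surface h v)}

/-- Straightness in the torus fixes both coordinates at every time; only the square is open, and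
continuity determines it. Time is shifted by `x` so that vertical edges are met at integers. -/
theorem ClosedLeaf.exists_eq_rowPath (hP : conePoints h v ⊆ P) (w : ClosedLeaf P 1 0) :
    ∃ i, ∃ x ∈ Set.Ico (0 : ℝ) 1, ∃ y ∈ Set.Ico (0 : ℝ) 1,
      w.toFun 0 = Surface.pt h v i x y ∧ ∀ t, w.toFun t = rowPath h v i y (x + t) := by
  obtain ⟨i, x, hx, y, hy, e0⟩ := (w.toFun 0).exists_pt
  have ex : ∀ s, ∃ j, w.toFun (s - x) = Surface.pt h v j (Int.fract s) y := by
    intro s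
    obtain ⟨j, x', hx', y', hy', e⟩ := (w.toFun (s - x)).exists_pt
    have hs := w.straight (s - x)
    rw [e, e0, Surface.toTorus_pt _ (Set.Ico_subset_Icc_self hx) (Set.Ico_subset_Icc_self hy),
      Surface.toTorus_pt _ (Set.Ico_subset_Icc_self hx') (Set.Ico_subset_Icc_self hy')] at hs
    have h1 := congrArg Prod.fst hs
    have h2 := congrArg Prod.snd hs
    simp at h1 h2
    have hy'' : y' = y := (AddCircle.coe_eq_coe_iff_of_mem_Ico (p := (1 : ℝ)) (a := 0)
      (by simpa using hy') (by simpa using hy)).1 h2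
    have hx'' : x' = Int.fract s := by
      refine (AddCircle.coe_eq_coe_iff_of_mem_Ico (p := (1 : ℝ)) (a := 0)
        (by simpa using hx') (by simp [Int.fract_nonneg, Int.fract_lt_one])).1 ?_
      rw [h1]
      nth_rewrite 1 [← Int.floor_add_fract s]
      rw [AddCircle.coe_add]
      simp
    exact ⟨j, by rw [e, hy'', hx'']⟩
  choose j hj using ex
  have hw : ∀ s, w.toFun (s - x) = rowPath h v (j 0) y s :=
    eq_rowPath (g := fun s => w.toFun (s - x)) (w.continuous_toFun.comp (by fun_prop)) hy hj
      fun s hs => w.avoids _ (hP hs)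
  refine ⟨j 0, x, hx, y, hy, ?_, fun t => ?_⟩
  · have := hw x
    rw [sub_self, rowPath, Int.floor_eq_zero_iff.2 hx, Int.fract_eq_self.2 hx] at this
    simpa using this
  · rw [← hw, add_sub_cancel_left]

/-! ### Row paths as leaves, and their periods -/

theorem rowPath_mem_Icc (i : Fin n) (y : ℝ) (m : ℤ) {s : ℝ} (hs : s ∈ Set.Icc (m : ℝ) (m + 1)) :
    rowPath h v i y s = Surface.pt h v ((h ^ m) i) (s - m) y := by
  rcases eq_or_lt_of_le hs.2 with rfl | hlt
  · rw [rowPath, add_sub_cancel_left, Surface.pt_right]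
    have : ⌊(m : ℝ) + 1⌋ = 1 + m := by rw [Int.floor_add_one, Int.floor_intCast, add_comm]
    rw [this, zpow_one_add]
    simp
  · have : ⌊s⌋ = m := Int.floor_eq_iff.2 ⟨hs.1, hlt⟩
    rw [rowPath, ← Int.self_sub_floor, this]

theorem continuous_rowPath (h v : Equiv.Perm (Fin n)) (i : Fin n) (y : ℝ) :
    Continuous (rowPath h v i y) := by
  have lf : LocallyFinite fun m : ℤ => Set.Icc (m : ℝ) (m + 1) := by
    intro x
    refine ⟨Metric.ball x 1, Metric.ball_mem_nhds x one_pos,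
      (Set.finite_Icc (⌊x⌋ - 2) (⌊x⌋ + 2)).subset ?_⟩
    rintro m ⟨z, hz, hzx⟩
    rw [Metric.mem_ball, Real.dist_eq, abs_lt] at hzx
    have h1 := Int.floor_le x
    have h2 := Int.lt_floor_add_one x
    constructor
    · have : ((⌊x⌋ - 2 : ℤ) : ℝ) ≤ m := by push_cast; linarith [hz.1, hz.2]
      exact_mod_cast this
    · have : (m : ℝ) ≤ ((⌊x⌋ + 2 : ℤ) : ℝ) := by push_cast; linarith [hz.1, hz.2]
      exact_mod_cast this
  refine lf.continuous ?_ (fun m => isClosed_Icc) fun m => ?_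
  · exact Set.eq_univ_of_forall fun x => Set.mem_iUnion.2
      ⟨⌊x⌋, Int.floor_le x, (Int.lt_floor_add_one x).le⟩
  · refine ContinuousOn.congr (Continuous.continuousOn ?_) fun s hs => rowPath_mem_Icc i y m hs
    exact Surface.continuous_pt _ (by fun_prop) (by fun_prop)

theorem toTorus_rowPath (i : Fin n) {y : ℝ} (hy : y ∈ Set.Ico (0 : ℝ) 1) (s : ℝ) :
    (rowPath h v i y s).toTorus = ((s : UnitAddCircle), (y : UnitAddCircle)) := by
  rw [rowPath, Surface.toTorus_pt _ (fract_mem_Icc s) (Set.Ico_subset_Icc_self hy)]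
  nth_rewrite 2 [← Int.floor_add_fract s]
  rw [AddCircle.coe_add]
  simp

theorem periodic_rowPath (i : Fin n) (y : ℝ) :
    Function.Periodic (rowPath h v i y) (Function.minimalPeriod h i : ℝ) := by
  intro s
  have e : (h ^ (Function.minimalPeriod h i)) i = i := by
    rw [← Equiv.Perm.iterate_eq_pow]
    exact Function.iterate_minimalPeriod
  rw [rowPath, rowPath, Int.floor_add_natCast, Int.fract_add_natCast, zpow_add, zpow_natCast,
    Equiv.Perm.mul_apply, e]

/-- The torus forces a period to be an integer `m`. At the midpoint of an edge the square is visible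
to `exists_edge_function`, so `h ^ m` fixes `i`. -/
theorem minimalPeriod_le_of_periodic (i : Fin n) {y : ℝ} (hy : y ∈ Set.Ico (0 : ℝ) 1) {T : ℝ}
    (hT : 0 < T) (hper : Function.Periodic (rowPath h v i y) T) :
    (Function.minimalPeriod h i : ℝ) ≤ T := by
  have e := congrArg Surface.toTorus (hper 0)
  rw [toTorus_rowPath i hy, toTorus_rowPath i hy] at e
  have e1 := congrArg Prod.fst e
  simp only [zero_add, AddCircle.coe_zero] at e1
  rw [AddCircle.coe_eq_zero_iff] at e1
  obtain ⟨m, hm⟩ := e1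
  simp only [zsmul_eq_mul, mul_one] at hm
  subst hm
  have hm0 : 0 < m := by exact_mod_cast hT
  lift m to ℕ using hm0.le
  have half := hper (1 / 2)
  rw [Int.cast_natCast, rowPath, rowPath, Int.floor_add_natCast, Int.fract_add_natCast,
    show ⌊(1 / 2 : ℝ)⌋ = 0 by norm_num, Int.fract_eq_self.2 (by norm_num), zero_add, zpow_natCast,
    zpow_zero, Equiv.Perm.one_apply] at half
  obtain ⟨F, -, κ, hκ, hF⟩ := exists_edge_function h v i hy
  have hFe := congrArg F half
  rw [hF _ _ (by norm_num), hF _ _ (by norm_num), if_pos rfl] at hFe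
  have hp : (h ^ m) i = i := by
    by_contra hne
    rw [if_neg hne] at hFe
    nlinarith
  rw [← Equiv.Perm.iterate_eq_pow] at hp
  have := Function.IsPeriodicPt.minimalPeriod_le (f := h) (by exact_mod_cast hm0) hp
  exact_mod_cast this

theorem minimalPeriod_perm_pos (h : Equiv.Perm (Fin n)) (i : Fin n) :
    0 < Function.minimalPeriod h i := by
  refine Function.IsPeriodicPt.minimalPeriod_pos (orderOf_pos h) ?_
  rw [Function.IsPeriodicPt, Function.IsFixedPt, Equiv.Perm.iterate_eq_pow, pow_orderOf_eq_one]
  rfl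

/-- The horizontal leaf at height `y` through the square `i`. -/
noncomputable def rowLeaf (h v : Equiv.Perm (Fin n)) (i : Fin n) (y : ℝ)
    (hy : y ∈ Set.Ioo (0 : ℝ) 1) : ClosedLeaf (vertices h v) 1 0 where
  toFun := rowPath h v i y
  period := Function.minimalPeriod h i
  continuous_toFun := continuous_rowPath h v i y
  avoids t := by
    rw [mem_vertices_iff, toTorus_rowPath i (Set.Ioo_subset_Ico_self hy)]
    intro e
    have e2 := congrArg Prod.snd e
    simp only [Prod.snd_zero] at e2
    rw [AddCircle.coe_eq_zero_iff_of_mem_Ico (by simpa using Set.Ioo_subset_Ico_self hy)] at e2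
    exact hy.1.ne' e2
  straight t := by
    simp [toTorus_rowPath i (Set.Ioo_subset_Ico_self hy)]
  period_pos := by exact_mod_cast minimalPeriod_perm_pos h i
  periodic := periodic_rowPath i y
  minimal s hs hper := minimalPeriod_le_of_periodic i (Set.Ioo_subset_Ico_self hy) hs hper

theorem ClosedLeaf.period_eq {w : ClosedLeaf P 1 0} {i : Fin n} {x y : ℝ}
    (hy : y ∈ Set.Ico (0 : ℝ) 1) (hw : ∀ t, w.toFun t = rowPath h v i y (x + t)) :
    w.period = Function.minimalPeriod h i := by
  apply le_antisymm
  · refine w.minimal _ (by exact_mod_cast minimalPeriod_perm_pos h i) fun t => ?_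
    rw [hw, hw, ← add_assoc, periodic_rowPath]
  · refine minimalPeriod_le_of_periodic (v := v) i hy w.period_pos fun s => ?_
    have := w.periodic (s - x)
    rw [hw, hw] at this
    convert this using 2 <;> ring

theorem ClosedLeaf.height_pos {w : ClosedLeaf (vertices h v) 1 0} {i : Fin n} {x y : ℝ}
    (hy : y ∈ Set.Ico (0 : ℝ) 1) (hw : ∀ t, w.toFun t = rowPath h v i y (x + t)) : 0 < y := by
  refine lt_of_le_of_ne hy.1 fun e => w.avoids (-x) ?_
  rw [mem_vertices_iff, hw, toTorus_rowPath i hy, ← e, add_neg_cancel]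
  rfl

/-! ### Horizontal cylinders -/

/-- The open horizontal strip through the square `i`. -/
def strip (h v : Equiv.Perm (Fin n)) (i : Fin n) : Set (Surface h v) :=
  ⋃ k : ℤ, (fun z : ℝ × ℝ => Surface.pt h v ((h ^ k) i) z.1 z.2) '' Set.Icc 0 1 ×ˢ Set.Ioo 0 1

theorem mem_strip {i : Fin n} {s : Surface h v} : s ∈ strip h v i ↔
    ∃ k : ℤ, ∃ x ∈ Set.Icc (0 : ℝ) 1, ∃ y ∈ Set.Ioo (0 : ℝ) 1,
      Surface.pt h v ((h ^ k) i) x y = s := by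
  simp only [strip, Set.mem_iUnion, Set.mem_image, Set.mem_prod, Prod.exists]
  constructor
  · rintro ⟨k, x, y, ⟨hx, hy⟩, e⟩; exact ⟨k, x, hx, y, hy, e⟩
  · rintro ⟨k, x, hx, y, hy, e⟩; exact ⟨k, x, y, ⟨hx, hy⟩, e⟩

theorem pt_mem_strip (i : Fin n) {x y : ℝ} (hx : x ∈ Set.Icc (0 : ℝ) 1)
    (hy : y ∈ Set.Ioo (0 : ℝ) 1) : Surface.pt h v i x y ∈ strip h v i :=
  mem_strip.2 ⟨0, x, hx, y, hy, by simp⟩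

theorem strip_eq_of_sameCycle {i j : Fin n} (hij : h.SameCycle i j) :
    strip h v i = strip h v j := by
  have key : ∀ {i j : Fin n}, h.SameCycle i j → strip h v j ⊆ strip h v i := by
    rintro i _ ⟨m, rfl⟩ s hs
    obtain ⟨k, x, hx, y, hy, rfl⟩ := mem_strip.1 hs
    exact mem_strip.2 ⟨k + m, x, hx, y, hy, by rw [zpow_add, Equiv.Perm.mul_apply]⟩
  exact (key hij.symm).antisymm (key hij)

theorem isPreconnected_strip (i : Fin n) : IsPreconnected (strip h v i) := by
  refine IsPreconnected.iUnion_of_chain (fun k => ?_) fun k => ?_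
  · refine (isPreconnected_Icc.prod isPreconnected_Ioo).image _ (Continuous.continuousOn ?_)
    exact Surface.continuous_pt _ continuous_fst continuous_snd
  · refine ⟨Surface.pt h v ((h ^ k) i) 1 (1 / 2), ⟨(1, 1 / 2), by norm_num, rfl⟩,
      ⟨(0, 1 / 2), by norm_num, ?_⟩⟩
    rw [Surface.pt_right, Order.succ_eq_add_one, add_comm, zpow_one_add]
    rfl

theorem closedLeafSet_eq : closedLeafSet (vertices h v) 1 0 = ⋃ i, strip h v i := by
  ext s
  rw [Set.mem_iUnion]
  constructor
  · rintro ⟨w, t, rfl⟩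
    obtain ⟨i, x, hx, y, hy, -, hw⟩ := w.exists_eq_rowPath conePoints_subset_vertices
    exact ⟨i, mem_strip.2 ⟨⌊x + t⌋, Int.fract (x + t), fract_mem_Icc _, y,
      ⟨ClosedLeaf.height_pos hy hw, hy.2⟩, (hw t).symm⟩⟩
  · rintro ⟨i, hs⟩
    obtain ⟨k, x, hx, y, hy, rfl⟩ := mem_strip.1 hs
    refine ⟨rowLeaf h v ((h ^ k) i) y hy, x, ?_⟩
    have := rowPath_mem_Icc (h := h) (v := v) ((h ^ k) i) y 0 (s := x) (by simpa using hx)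
    simp only [zpow_zero, Equiv.Perm.one_apply, Int.cast_zero, sub_zero] at this
    exact this

/-- A set of squares that is a union of rows is separated from the other squares by a continuous
function. -/
theorem exists_row_function (h v : Equiv.Perm (Fin n)) (A : Set (Fin n))
    (hA : ∀ i, h i ∈ A ↔ i ∈ A) :
    ∃ F : Surface h v → ℝ, Continuous F ∧ ∀ i, ∀ x ∈ Set.Icc (0 : ℝ) 1, ∀ y ∈ Set.Ioo (0 : ℝ) 1,
      0 < F (Surface.pt h v i x y) ↔ i ∈ A := by
  classical
  refine ⟨Surface.lift (fun i _ y => (if i ∈ A then 1 else 0) * (y * (1 - y) : ℝ))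
    (fun i y => by simp [hA]) (fun i x => by simp), Surface.continuous_lift _ _ fun i => by fun_prop,
    fun i x hx y hy => ?_⟩
  rw [Surface.lift_pt, coe_clamp hy.1.le hy.2.le]
  have : 0 < y * (1 - y) := mul_pos hy.1 (by linarith [hy.2])
  split_ifs with hi <;> simp [hi, this]

theorem mem_zpow_iff {A : Set (Fin n)} (hA : ∀ i, h i ∈ A ↔ i ∈ A) (k : ℤ) (i : Fin n) :
    (h ^ k) i ∈ A ↔ i ∈ A := by
  induction k using Int.induction_on with
  | zero => simp
  | succ k ih => rw [add_comm, zpow_one_add, Equiv.Perm.mul_apply, hA, ih]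
  | pred k ih => rw [← hA, ← ih, sub_eq_neg_add, zpow_add, zpow_neg_one, Equiv.Perm.mul_apply,
      perm_apply_inv]

/-- A strip is connected, and two continuous functions, positive on the row of `i` and on the other
rows respectively, split the union of strips into disjoint open parts. -/
theorem connectedComponentIn_strip {i : Fin n} {s : Surface h v} (hs : s ∈ strip h v i) :
    connectedComponentIn (⋃ i, strip h v i) s = strip h v i := by
  apply Set.Subset.antisymm
  · have hA : ∀ j, h j ∈ {j | h.SameCycle i j} ↔ j ∈ {j | h.SameCycle i j} := fun j =>
      Equiv.Perm.sameCycle_apply_right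
    have hA' : ∀ j, h j ∈ {j | h.SameCycle i j}ᶜ ↔ j ∈ {j | h.SameCycle i j}ᶜ := fun j =>
      not_congr (hA j)
    obtain ⟨F, hF, hFA⟩ := exists_row_function h v _ hA
    obtain ⟨G, hG, hGA⟩ := exists_row_function h v _ hA'
    have rep : ∀ r ∈ ⋃ i, strip h v i, ∃ j, ∃ x ∈ Set.Icc (0 : ℝ) 1, ∃ y ∈ Set.Ioo (0 : ℝ) 1,
        Surface.pt h v j x y = r := by
      intro r hr
      obtain ⟨j, hr⟩ := Set.mem_iUnion.1 hr
      obtain ⟨k, x, hx, y, hy, e⟩ := mem_strip.1 hr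
      exact ⟨_, x, hx, y, hy, e⟩
    have hsU : s ∈ ⋃ i, strip h v i := Set.mem_iUnion.2 ⟨i, hs⟩
    have sub : connectedComponentIn (⋃ i, strip h v i) s ⊆ {r | 0 < F r} := by
      have hpre : IsPreconnected (connectedComponentIn (⋃ i, strip h v i) s) :=
        isPreconnected_connectedComponentIn
      have hU := connectedComponentIn_subset (⋃ i, strip h v i) s
      by_contra hnot
      obtain ⟨r, hr, hrF⟩ := Set.not_subset.1 hnot
      have hrG : 0 < G r := by
        obtain ⟨j, x, hx, y, hy, rfl⟩ := rep r (hU hr)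
        rw [hGA _ _ hx _ hy]
        exact fun hj => hrF ((hFA _ _ hx _ hy).2 hj)
      have hsF : 0 < F s := by
        obtain ⟨k, x, hx, y, hy, rfl⟩ := mem_strip.1 hs
        rw [hFA _ _ hx _ hy]
        exact ⟨k, rfl⟩
      obtain ⟨z, hz, hzF, hzG⟩ := hpre {r | 0 < F r} {r | 0 < G r}
        (isOpen_lt continuous_const hF) (isOpen_lt continuous_const hG)
        (fun r hr => by
          obtain ⟨j, x, hx, y, hy, rfl⟩ := rep r (hU hr)
          by_cases hj : h.SameCycle i j
          · exact Or.inl ((hFA _ _ hx _ hy).2 hj)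
          · exact Or.inr ((hGA _ _ hx _ hy).2 hj))
        ⟨s, mem_connectedComponentIn hsU, hsF⟩ ⟨r, hr, hrG⟩
      obtain ⟨j, x, hx, y, hy, rfl⟩ := rep z (hU hz)
      exact (hGA _ _ hx _ hy).1 hzG ((hFA _ _ hx _ hy).1 hzF)
    intro r hr
    have hrF := sub hr
    obtain ⟨j, x, hx, y, hy, rfl⟩ := rep r (connectedComponentIn_subset _ _ hr)
    rw [strip_eq_of_sameCycle ((hFA _ _ hx _ hy).1 hrF)]
    exact pt_mem_strip j hx hy
  · exact (isPreconnected_strip i).subset_connectedComponentIn hs (Set.subset_iUnion _ i)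

theorem cylinders_horizontal : cylinders (vertices h v) 1 0 = Set.range (strip h v) := by
  ext C
  rw [cylinders, closedLeafSet_eq]
  constructor
  · rintro ⟨s, hs, rfl⟩
    obtain ⟨i, hs⟩ := Set.mem_iUnion.1 hs
    exact ⟨i, (connectedComponentIn_strip hs).symm⟩
  · rintro ⟨i, rfl⟩
    have hm : Surface.pt h v i 0 (1 / 2) ∈ strip h v i := pt_mem_strip i (by simp) (by norm_num)
    exact ⟨_, Set.mem_iUnion.2 ⟨i, hm⟩, (connectedComponentIn_strip hm).symm⟩

theorem closure_cylinders_horizontal :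
    closure (⋃₀ cylinders (vertices h v) 1 0) = Set.univ := by
  rw [cylinders_horizontal, Set.sUnion_range, Set.eq_univ_iff_forall]
  intro s
  obtain ⟨i, x, hx, y, hy, rfl⟩ := s.exists_pt
  have hc : Continuous fun y : ℝ => Surface.pt h v i x y :=
    Surface.continuous_pt i continuous_const continuous_id
  have hm : Set.MapsTo (fun y : ℝ => Surface.pt h v i x y) (Set.Ioo 0 1) (⋃ i, strip h v i) :=
    fun y hy => Set.mem_iUnion.2 ⟨i, pt_mem_strip i (Set.Ico_subset_Icc_self hx) hy⟩
  refine hm.closure hc ?_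
  rw [closure_Ioo zero_ne_one]
  exact Set.Ico_subset_Icc_self hy

/-- Rows that differ in an invariant of the horizontal permutation have different strips. -/
theorem strip_ne {α : Type*} (f : Fin n → α) (hf : ∀ i, f (h i) = f i) {i j : Fin n}
    (hij : f i ≠ f j) : strip h v i ≠ strip h v j := by
  intro e
  have hA : ∀ k, h k ∈ {k | f k = f i} ↔ k ∈ {k | f k = f i} := fun k => by simp [hf]
  obtain ⟨F, -, hFA⟩ := exists_row_function h v _ hA
  have hm : Surface.pt h v j 0 (1 / 2) ∈ strip h v i := e ▸ pt_mem_strip j (by simp) (by norm_num)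
  obtain ⟨k, x, hx, y, hy, e'⟩ := mem_strip.1 hm
  have : 0 < F (Surface.pt h v j 0 (1 / 2)) := by
    rw [← e', hFA _ _ hx _ hy, mem_zpow_iff hA]; rfl
  rw [hFA _ _ (by simp) _ (by norm_num)] at this
  exact hij this.symm

/-- The square of a leaf that starts in the strip of `i` is in the row of `i`. -/
theorem invariant_eq_of_mem_strip {α : Type*} (f : Fin n → α) (hf : ∀ i, f (h i) = f i)
    {i j : Fin n} {x y : ℝ} (hx : x ∈ Set.Icc (0 : ℝ) 1) (hy : y ∈ Set.Ioo (0 : ℝ) 1)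
    (hm : Surface.pt h v j x y ∈ strip h v i) : f j = f i := by
  have hA : ∀ k, h k ∈ {k | f k = f i} ↔ k ∈ {k | f k = f i} := fun k => by simp [hf]
  obtain ⟨F, -, hFA⟩ := exists_row_function h v _ hA
  obtain ⟨k, x', hx', y', hy', e'⟩ := mem_strip.1 hm
  have : 0 < F (Surface.pt h v j x y) := by
    rw [← e', hFA _ _ hx' _ hy', mem_zpow_iff hA]; rfl
  exact (hFA _ _ hx _ hy).1 this

end Horizontal
end Origami

namespace Origami

/-! ### Homology classes of horizontal leaves -/

section HorizontalHomology

variable {n : ℕ} {h v : Equiv.Perm (Fin n)}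

/-- The chart of the square `i`, extended to the plane. -/
noncomputable def squareMap (h v : Equiv.Perm (Fin n)) (i : Fin n) : C(ℝ × ℝ, Surface h v) :=
  ⟨fun z => Surface.pt h v i z.1 z.2, Surface.continuous_pt i continuous_fst continuous_snd⟩

/-- The class of the horizontal segment at height `y` in the square `i`. -/
noncomputable def rowClass (h v : Equiv.Perm (Fin n)) (y : ℝ) (i : Fin n) :
    (singularChains (Surface h v)).opcycles 1 :=
  simplexClass (segment (squareMap h v i) (0, y) (1, y))

/-- The class of the left side of the square `i` up to the height `y`. -/
noncomputable def columnClass (h v : Equiv.Perm (Fin n)) (y : ℝ) (i : Fin n) :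
    (singularChains (Surface h v)).opcycles 1 :=
  simplexClass (segment (squareMap h v i) (0, 0) (0, y))

/-- The diagonal cuts the rectangle below height `y` into two triangles; its right side is the left
side of `h i`. The correction terms telescope along a cycle of `h`. -/
theorem rowClass_eq (y : ℝ) (i : Fin n) :
    rowClass h v y i = rowClass h v 0 i + (columnClass h v y (h i) - columnClass h v y i) := by
  have h1 := simplexClass_segment_add (squareMap h v i) (0, 0) (1, 0) (1, y)
  have h2 := simplexClass_segment_add (squareMap h v i) (0, 0) (0, y) (1, y)
  have e : segment (squareMap h v i) (1, 0) (1, y) = segment (squareMap h v (h i)) (0, 0) (0, y) := by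
    ext t
    simp [segment, squareMap, Surface.pt_right]
  rw [e] at h1
  have := h1.trans h2.symm
  change rowClass h v 0 i + columnClass h v y (h i) = columnClass h v y i + rowClass h v y i at this
  rw [add_sub, this, add_sub_cancel_left]

theorem rowClass_one (i : Fin n) : rowClass h v 1 i = rowClass h v 0 (v i) := by
  rw [rowClass, rowClass]
  congr 1
  ext t
  simp [segment, squareMap, Surface.pt_top]

theorem sum_rowClass (y : ℝ) (i : Fin n) :
    ∑ k ∈ Finset.range (Function.minimalPeriod h i), rowClass h v y ((h ^ k) i) =
      ∑ k ∈ Finset.range (Function.minimalPeriod h i), rowClass h v 0 ((h ^ k) i) := by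
  have e : ∀ k : ℕ, h ((h ^ k) i) = (h ^ (k + 1)) i := fun k => by
    rw [pow_succ', Equiv.Perm.mul_apply]
  have hp : (h ^ (Function.minimalPeriod h i)) i = i := by
    rw [← Equiv.Perm.iterate_eq_pow]
    exact Function.iterate_minimalPeriod
  simp only [rowClass_eq y, Finset.sum_add_distrib, e]
  rw [Finset.sum_range_sub fun k => columnClass h v y ((h ^ k) i), hp]
  simp

/-- The bottom and the top of a row are homologous. -/
theorem sum_rowClass_top (i : Fin n) :
    ∑ k ∈ Finset.range (Function.minimalPeriod h i), rowClass h v 0 ((h ^ k) i) =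
      ∑ k ∈ Finset.range (Function.minimalPeriod h i), rowClass h v 0 (v ((h ^ k) i)) := by
  rw [← sum_rowClass 1]
  simp only [rowClass_one]

theorem simplexClass_segment_nat {X : Type} [TopologicalSpace X] (g : C(ℝ, X)) (m : ℕ) :
    simplexClass (segment g 0 m) =
      ∑ k ∈ Finset.range m, simplexClass (segment g (k : ℝ) (k + 1)) := by
  induction m with
  | zero =>
    have := simplexClass_segment_add g 0 0 0
    rw [add_eq_left] at this
    simpa using this
  | succ m ih =>
    rw [Finset.sum_range_succ, ← ih, simplexClass_segment_add]
    push_cast; rfl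

theorem simplexClass_segment_periodic {X : Type} [TopologicalSpace X] (g : C(ℝ, X)) {T : ℝ}
    (hg : Function.Periodic g T) (x : ℝ) :
    simplexClass (segment g x (x + T)) = simplexClass (segment g 0 T) := by
  have h1 := simplexClass_segment_add g 0 x (x + T)
  have h2 := simplexClass_segment_add g 0 T (x + T)
  have e : segment g T (x + T) = segment g 0 x := by
    ext t
    simp only [segment, ContinuousMap.coe_mk, smul_eq_mul]
    rw [← hg ((1 - (t : ℝ)) * 0 + t * x)]
    congr 1; ring
  rw [e] at h2
  rw [← add_right_inj (simplexClass (segment g 0 x)), h1, ← h2, add_comm]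

/-- The starting point is moved to a vertical edge by periodicity, the loop is cut at integers, and
the pieces are slid down to height 0. The class therefore depends on the row only. -/
theorem homologyInclusion_homologyClass {P : Set (Surface h v)} {w : ClosedLeaf P 1 0} {i : Fin n}
    {x y : ℝ} (hy : y ∈ Set.Ico (0 : ℝ) 1) (hw : ∀ t, w.toFun t = rowPath h v i y (x + t)) :
    homologyInclusion _ w.homologyClass =
      ∑ k ∈ Finset.range (Function.minimalPeriod h i), rowClass h v 0 ((h ^ k) i) := by
  let g : C(ℝ, Surface h v) := ⟨rowPath h v i y, continuous_rowPath h v i y⟩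
  rw [ClosedLeaf.homologyClass, homologyInclusion_loopClass]
  have e : w.loop.toContinuousMap = segment g x (x + Function.minimalPeriod h i) := by
    ext t
    change w.toFun (t * w.period) = _
    rw [hw, ClosedLeaf.period_eq hy hw]
    simp only [segment, g, ContinuousMap.coe_mk, smul_eq_mul]
    congr 1; ring
  rw [e, simplexClass_segment_periodic g (periodic_rowPath i y), simplexClass_segment_nat,
    ← sum_rowClass y]
  refine Finset.sum_congr rfl fun k _ => ?_
  rw [rowClass]
  congr 1
  ext t
  simp only [segment, g, squareMap, ContinuousMap.coe_mk]
  rw [rowPath_mem_Icc i y k ⟨?_, ?_⟩]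
  · congr 1 <;> simp
    all_goals ring
  · simp; nlinarith [t.2.1]
  · simp; nlinarith [t.2.2]

/-- Integers on the squares that are constant in the vertical direction define a functional. -/
theorem exists_column_functional (h v : Equiv.Perm (Fin n)) (a : Fin n → ℤ)
    (ha : ∀ i, a (v i) = a i) :
    ∃ φ : (singularChains (Surface h v)).opcycles 1 →ₗ[ℝ] ℝ, ∀ i, φ (rowClass h v 0 i) = a i := by
  -- Integrality of `a i` makes `a i * x` vanish in the circle at both vertical sides, so no
  -- condition links horizontal neighbours.
  let f : C(Surface h v, UnitAddCircle) :=
    ⟨Surface.lift (fun i x _ => ((a i * x : ℝ) : UnitAddCircle))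
      (fun i y => by simp) (fun i x => by simp [ha]),
      Surface.continuous_lift _ _ fun i =>
        (AddCircle.continuous_mk' 1).comp (by fun_prop)⟩
  obtain ⟨φ, hφ⟩ := exists_argument_functional f
  refine ⟨φ, fun i => ?_⟩
  rw [rowClass, hφ, argumentChange_eq _ ⟨fun t => (a i * t : ℝ), by fun_prop⟩ fun t => ?_]
  · simp
  · simp [f, segment, squareMap, Surface.lift_pt]

end HorizontalHomology

/-! ### The horizontal direction of the origami -/

/-- The row of a square. -/
def row : Fin 16 → Fin 4 := ![3, 0, 0, 0, 0, 0, 0, 1, 1, 1, 1, 1, 1, 2, 2, 3]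

theorem row_hO (i : Fin 16) : row (hO i) = row i := by
  rw [hO_apply]; revert i; decide

theorem hO_pow_apply (k : ℕ) (i : Fin 16) :
    (hO ^ k) i = (![15, 2, 3, 4, 5, 6, 1, 12, 7, 8, 9, 10, 11, 14, 13, 0])^[k] i := by
  rw [← Equiv.Perm.iterate_eq_pow, show ⇑hO = _ from funext hO_apply]

theorem minimalPeriod_eq_of_forall {α : Type*} {f : α → α} {x : α} {m : ℕ} (hm : 0 < m)
    (hx : f^[m] x = x) (hne : ∀ k < m, 0 < k → f^[k] x ≠ x) : Function.minimalPeriod f x = m := by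
  refine le_antisymm (Function.IsPeriodicPt.minimalPeriod_le hm hx) (not_lt.1 fun hlt => ?_)
  exact hne _ hlt (Function.IsPeriodicPt.minimalPeriod_pos hm hx) Function.iterate_minimalPeriod

theorem minimalPeriod_hO (i : Fin 16) :
    Function.minimalPeriod hO i = if row i = 0 ∨ row i = 1 then 6 else 2 := by
  have e : ⇑hO = ![15, 2, 3, 4, 5, 6, 1, 12, 7, 8, 9, 10, 11, 14, 13, 0] := funext hO_apply
  rw [e]
  apply minimalPeriod_eq_of_forall
  · split_ifs <;> norm_num
  · revert i; decide
  · revert i; decide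

theorem sameCycle_hO (i : Fin 16) : hO.SameCycle (![1, 7, 13, 15] (row i)) i := by
  have : ∃ k : Fin 6, (![15, 2, 3, 4, 5, 6, 1, 12, 7, 8, 9, 10, 11, 14, 13, 0] : Fin 16 → Fin 16)^[k]
      (![1, 7, 13, 15] (row i)) = i := by
    revert i; decide
  obtain ⟨k, hk⟩ := this
  exact ⟨(k : ℕ), by rw [zpow_natCast, hO_pow_apply]; exact hk⟩

theorem sum_map_range {M : Type*} [AddCommMonoid M] (S : Fin 16 → M) {g : ℕ → Fin 16} {m : ℕ}
    {s : Multiset (Fin 16)} (e : (Multiset.range m).map g = s) :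
    ∑ k ∈ Finset.range m, S (g k) = (s.map S).sum := by
  rw [← e, Multiset.map_map]; rfl

/-- The class of the long waist curves. -/
noncomputable def longClass : (singularChains (Surface hO vO)).opcycles 1 :=
  (Multiset.map (rowClass hO vO 0) {1, 2, 3, 4, 5, 6}).sum

/-- The class of the short waist curves. -/
noncomputable def shortClass : (singularChains (Surface hO vO)).opcycles 1 :=
  (Multiset.map (rowClass hO vO 0) {13, 14}).sum

/-- Rows 0 and 2 are the reference rows. Rows 1 and 3 are pushed to their tops, which `vO` glues to
the bottoms of rows 0 and 2; multisets ignore the order of the squares. -/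
theorem sum_rowClass_hO (i : Fin 16) :
    ∑ k ∈ Finset.range (Function.minimalPeriod hO i), rowClass hO vO 0 ((hO ^ k) i) =
      if row i = 0 ∨ row i = 1 then longClass else shortClass := by
  have cases : row i = 0 ∨ row i = 1 ∨ row i = 2 ∨ row i = 3 := by revert i; decide
  rcases cases with hi | hi | hi | hi
  · rw [minimalPeriod_hO, if_pos (by simp [hi]), if_pos (by simp [hi])]
    refine sum_map_range (rowClass hO vO 0) ?_
    simp only [hO_pow_apply]
    revert i; decide
  · rw [sum_rowClass_top, minimalPeriod_hO, if_pos (by simp [hi]), if_pos (by simp [hi])]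
    refine sum_map_range (rowClass hO vO 0) (g := fun k => vO ((hO ^ k) i)) ?_
    simp only [hO_pow_apply, vO_apply]
    revert i; decide
  · rw [minimalPeriod_hO, if_neg (by simp [hi]), if_neg (by simp [hi])]
    refine sum_map_range (rowClass hO vO 0) ?_
    simp only [hO_pow_apply]
    revert i; decide
  · rw [sum_rowClass_top, minimalPeriod_hO, if_neg (by simp [hi]), if_neg (by simp [hi])]
    refine sum_map_range (rowClass hO vO 0) (g := fun k => vO ((hO ^ k) i)) ?_
    simp only [hO_pow_apply, vO_apply]
    revert i; decide

theorem linearIndependent_longClass_shortClass :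
    LinearIndependent ℝ ![longClass, shortClass] := by
  -- The weights are indicators of vertical cycles. The cycle `(4, 8)` meets the squares 1, ..., 6
  -- once and misses 13 and 14; the cycle of 14 contains 14 but not 13.
  obtain ⟨φ, hφ⟩ := exists_column_functional hO vO
    ![0, 0, 0, 0, 1, 0, 0, 0, 1, 0, 0, 0, 0, 0, 0, 0]
    (by intro i; rw [vO_apply]; revert i; decide)
  obtain ⟨ψ, hψ⟩ := exists_column_functional hO vO
    ![1, 0, 1, 0, 0, 0, 1, 0, 0, 0, 1, 0, 1, 0, 1, 0]
    (by intro i; rw [vO_apply]; revert i; decide)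
  have hL : φ longClass = 1 := by simp [longClass, hφ]
  have hS : φ shortClass = 0 := by simp [shortClass, hφ]
  have hS' : ψ shortClass = 1 := by simp [shortClass, hψ]
  rw [LinearIndependent.pair_iff]
  intro s t hst
  have h1 := congrArg φ hst
  rw [map_add, map_smul, map_smul, hL, hS] at h1
  have hs : s = 0 := by simpa using h1
  subst hs
  have h2 := congrArg ψ hst
  rw [map_add, map_smul, map_smul, hS'] at h2
  exact ⟨rfl, by simpa using h2⟩

theorem homologyInclusion_homologyClass_hO {P : Set (Surface hO vO)} {w : ClosedLeaf P 1 0}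
    {i : Fin 16} {x y : ℝ} (hy : y ∈ Set.Ico (0 : ℝ) 1)
    (hw : ∀ t, w.toFun t = rowPath hO vO i y (x + t)) :
    homologyInclusion _ w.homologyClass =
      if row i = 0 ∨ row i = 1 then longClass else shortClass := by
  rw [homologyInclusion_homologyClass hy hw, sum_rowClass_hO]

/-- A vertex-free leaf, regarded as a leaf that avoids fewer points. -/
def ClosedLeaf.ofSubset {n : ℕ} {h v : Equiv.Perm (Fin n)} {P Q : Set (Surface h v)} {p q : ℤ}
    (hPQ : P ⊆ Q) (w : ClosedLeaf Q p q) : ClosedLeaf P p q :=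
  { w with avoids := fun t ht => w.avoids t (hPQ ht) }

/-- Leaves avoiding the cone points have no classes beyond these two, and leaves at height 1/2,
which avoid all vertices, already realize both. So every `P` in between gives the same span. -/
theorem finrank_waistSpan_hO {P : Set (Surface hO vO)} (hP : conePoints hO vO ⊆ P)
    (hP' : P ⊆ vertices hO vO) : Module.finrank ℝ (waistSpan P 1 0) = 2 := by
  have e : (waistSpan P 1 0).map (homologyInclusion _) =
      Submodule.span ℝ (Set.range ![longClass, shortClass]) := by
    rw [waistSpan, Submodule.map_span, ← Set.range_comp]
    congr 1
    ext c
    simp only [Matrix.range_cons, Matrix.range_empty, Set.union_empty, Set.mem_union,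
      Set.mem_singleton_iff, Set.mem_range, Function.comp]
    constructor
    · rintro ⟨w, rfl⟩
      obtain ⟨i, x, hx, y, hy, -, hw⟩ := w.exists_eq_rowPath hP
      rw [homologyInclusion_homologyClass_hO hy hw]
      split_ifs <;> simp
    · have hh : (1 / 2 : ℝ) ∈ Set.Ioo (0 : ℝ) 1 := by norm_num
      have real : ∀ i, ∃ w : ClosedLeaf P 1 0, homologyInclusion _ w.homologyClass =
          if row i = 0 ∨ row i = 1 then longClass else shortClass := fun i =>
        ⟨(rowLeaf hO vO i (1 / 2) hh).ofSubset hP',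
          homologyInclusion_homologyClass_hO (x := 0) (Set.Ioo_subset_Ico_self hh) fun t => by
            rw [zero_add]; rfl⟩
      rintro (rfl | rfl)
      · exact real 1
      · exact real 13
  rw [(Submodule.equivMapOfInjective _ homologyInclusion_injective _).finrank_eq, e,
    finrank_span_eq_card linearIndependent_longClass_shortClass]
  rfl

theorem row_eq_of_mem_strip {w : ClosedLeaf (vertices hO vO) 1 0} {i j : Fin 16} {x y : ℝ}
    (hx : x ∈ Set.Ico (0 : ℝ) 1) (hy : y ∈ Set.Ico (0 : ℝ) 1)
    (h0 : w.toFun 0 = Surface.pt hO vO j x y)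
    (hw : ∀ t, w.toFun t = rowPath hO vO j y (x + t)) (hm : w.toFun 0 ∈ strip hO vO i) :
    row j = row i := by
  rw [h0] at hm
  exact invariant_eq_of_mem_strip row row_hO (Set.Ico_subset_Icc_self hx)
    ⟨ClosedLeaf.height_pos hy hw, hy.2⟩ hm

theorem hasTwoCylinderPairs_horizontal : HasTwoCylinderPairs hO vO 1 0 := by
  have hlong : ∀ w : ClosedLeaf (vertices hO vO) 1 0,
      w.toFun 0 ∈ strip hO vO 1 ∪ strip hO vO 7 →
        w.period = 6 ∧ homologyInclusion _ w.homologyClass = longClass := by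
    intro w hm
    obtain ⟨i, x, hx, y, hy, h0, hw⟩ := w.exists_eq_rowPath conePoints_subset_vertices
    have hi : row i = 0 ∨ row i = 1 := hm.imp (row_eq_of_mem_strip hx hy h0 hw)
      (row_eq_of_mem_strip hx hy h0 hw)
    rw [homologyInclusion_homologyClass_hO hy hw, ClosedLeaf.period_eq hy hw, minimalPeriod_hO,
      if_pos hi, if_pos hi]
    exact ⟨by norm_num, rfl⟩
  have hshort : ∀ w : ClosedLeaf (vertices hO vO) 1 0,
      w.toFun 0 ∈ strip hO vO 13 ∪ strip hO vO 15 →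
        w.period = 2 ∧ homologyInclusion _ w.homologyClass = shortClass := by
    intro w hm
    obtain ⟨i, x, hx, y, hy, h0, hw⟩ := w.exists_eq_rowPath conePoints_subset_vertices
    have hi : row i = 2 ∨ row i = 3 := hm.imp (row_eq_of_mem_strip hx hy h0 hw)
      (row_eq_of_mem_strip hx hy h0 hw)
    have hi' : ¬ (row i = 0 ∨ row i = 1) := by rcases hi with hi | hi <;> simp [hi]
    rw [homologyInclusion_homologyClass_hO hy hw, ClosedLeaf.period_eq hy hw, minimalPeriod_hO,
      if_neg hi', if_neg hi']
    exact ⟨by norm_num, rfl⟩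
  refine ⟨finrank_waistSpan_hO subset_rfl conePoints_subset_vertices,
    finrank_waistSpan_hO conePoints_subset_vertices subset_rfl, closure_cylinders_horizontal,
    strip hO vO 1, strip hO vO 7, strip hO vO 13, strip hO vO 15, ?_, ?_,
    fun w hw => (hlong w hw).1, fun w hw => (hshort w hw).1,
    fun w w' hw hw' => homologyInclusion_injective ((hlong w hw).2.trans (hlong w' hw').2.symm),
    fun w w' hw hw' => homologyInclusion_injective ((hshort w hw).2.trans (hshort w' hw').2.symm)⟩
  · have ne : ∀ i j : Fin 16, row i ≠ row j → strip hO vO i ≠ strip hO vO j := fun i j =>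
      strip_ne row row_hO
    simp only [List.nodup_cons, List.mem_cons, List.not_mem_nil, or_false, not_or, not_false_eq_true,
      List.nodup_nil, and_true]
    exact ⟨⟨ne _ _ (by decide), ne _ _ (by decide), ne _ _ (by decide)⟩,
      ⟨ne _ _ (by decide), ne _ _ (by decide)⟩, ne _ _ (by decide)⟩
  · rw [cylinders_horizontal]
    ext C
    simp only [Set.mem_range, Set.mem_insert_iff, Set.mem_singleton_iff]
    constructor
    · rintro ⟨i, rfl⟩
      rw [← strip_eq_of_sameCycle (sameCycle_hO i)]
      have : ∀ r : Fin 4, r = 0 ∨ r = 1 ∨ r = 2 ∨ r = 3 := by decide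
      rcases this (row i) with hr | hr | hr | hr <;> simp [hr]
    · rintro (rfl | rfl | rfl | rfl) <;> exact ⟨_, rfl⟩

end Origami

theorem proposition2p2 (p q : ℤ) (hpq : IsCoprime p q) :
    -- homological dimension two, for the cylinders cut out by the conical singularities and for
    -- those cut out by all vertices of the squares
    Module.finrank ℝ (Origami.waistSpan (Origami.conePoints Origami.hO Origami.vO) p q) = 2 ∧
    Module.finrank ℝ (Origami.waistSpan (Origami.vertices Origami.hO Origami.vO) p q) = 2 ∧
    -- the cylinders cut out by all vertices
    closure (⋃₀ Origami.cylinders (Origami.vertices Origami.hO Origami.vO) p q) = Set.univ ∧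
    ∃ L₁ L₂ S₁ S₂ : Set (Origami.Surface Origami.hO Origami.vO),
      [L₁, L₂, S₁, S₂].Nodup ∧
      Origami.cylinders (Origami.vertices Origami.hO Origami.vO) p q = {L₁, L₂, S₁, S₂} ∧
      (∀ w : Origami.ClosedLeaf (Origami.vertices Origami.hO Origami.vO) p q,
        w.toFun 0 ∈ L₁ ∪ L₂ → w.length = 6 * Real.sqrt ((p : ℝ) ^ 2 + (q : ℝ) ^ 2)) ∧
      (∀ w : Origami.ClosedLeaf (Origami.vertices Origami.hO Origami.vO) p q,
        w.toFun 0 ∈ S₁ ∪ S₂ → w.length = 2 * Real.sqrt ((p : ℝ) ^ 2 + (q : ℝ) ^ 2)) ∧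
      (∀ w w' : Origami.ClosedLeaf (Origami.vertices Origami.hO Origami.vO) p q,
        w.toFun 0 ∈ L₁ ∪ L₂ → w'.toFun 0 ∈ L₁ ∪ L₂ → w.homologyClass = w'.homologyClass) ∧
      (∀ w w' : Origami.ClosedLeaf (Origami.vertices Origami.hO Origami.vO) p q,
        w.toFun 0 ∈ S₁ ∪ S₂ → w'.toFun 0 ∈ S₁ ∪ S₂ → w.homologyClass = w'.homologyClass) := by

  obtain ⟨h1, h2, h3, L₁, L₂, S₁, S₂, hnd, hc, hL, hS, hL', hS'⟩ :=
    Origami.hasTwoCylinderPairs_horizontal.of_horizontal _ p q rfl hpq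
  refine ⟨h1, h2, h3, L₁, L₂, S₁, S₂, hnd, hc, fun w hw => ?_, fun w hw => ?_, hL', hS'⟩
  · rw [Origami.ClosedLeaf.length, hL w hw]
  · rw [Origami.ClosedLeaf.length, hS w hw]
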